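/- Let $K$ be an infinite field and let $S=K[x_1,\ldots,x_n]$ with the standard grading and $\mathfrak m=(x_1,\ldots,x_n)$. For an $S$-module $N$ let $\operatorname{depth}(N)$ be the supremum of the lengths of $N$-regular sequences contained in $\mathfrak m$. For a finitely generated graded $S$-module $M=\bigoplus_{j\ge 0}M_j$ put $H_M(t)=\sum_{j\geq 0}(\dim_K M_j)t^j$, and let the Hilbert depth of $M$ be $$\operatorname{hdepth}(M)=\max\{\operatorname{depth}(N)\;:\;N\text{ a finitely generated graded }S\text{-module with }H_N(t)=H_M(t)\}.$$ For a monomial ideal $I\subsetneq S$, a Stanley decomposition of $S/I$ is a finite decomposition $\mathcal D:\ S/I=\bigoplus_{i=1}^r m_iK[Z_i]$ as a direct sum of $K$-vector spaces, where $m_i\in S$ are monomials, $Z_i\subset\{x_1,\ldots,x_n\}$, and each $m_iK[Z_i]\subset S/I$ (the set of residue classes of $m_i f$ with $f\in K[Z_i]$) is a free $K[Z_i]$-module; the Stanley depth $\operatorname{sdepth}(S/I)$ is the maximum of $\min_i|Z_i|$ over all Stanley decompositions of $S/I$. Let $\dim(S/I)$ be the Krull dimension; $S/I$ is Cohen–Macaulay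 if $\dim(S/I)=\operatorname{depth}(S/I)$. Let $I\subsetneq S$ be an ideal generated by squarefree monomials such that $S/I$ is Cohen–Macaulay. Then: (1) $\operatorname{sdepth}(S/I)\leq \operatorname{hdepth}(S/I)=\dim(S/I)=\operatorname{depth}(S/I)$. (2) If $I\neq 0$, then $\operatorname{hdepth}(I)\geq\operatorname{hdepth}(S/I)+1$. -/

import Mathlib

universe u

open MvPolynomial

noncomputable section

namespace HilbertDepth

/-- The graded maximal ideal `(x₁, …, xₙ)` of `K[x₁, …, xₙ]`. -/
def maxIdeal (K : Type u) [Field K] (n : ℕ) : Ideal (MvPolynomial (Fin n) K) :=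
  Ideal.span (Set.range X)

/-- The depth of a module `N` over `S = K[x₁, …, xₙ]` with respect to the graded maximal ideal
`𝔪 = (x₁, …, xₙ)`: the supremum of the lengths of the `N`-regular sequences contained in `𝔪`. -/
def depth (K : Type u) [Field K] (n : ℕ) (N : Type*) [AddCommGroup N]
    [Module (MvPolynomial (Fin n) K) N] : ℕ∞ :=
  sSup {l : ℕ∞ | ∃ rs : List (MvPolynomial (Fin n) K),
    (∀ r ∈ rs, r ∈ maxIdeal K n) ∧ RingTheory.Sequence.IsRegular N rs ∧ l = rs.length}

/-- `N = ⨁ⱼ 𝒩 j` is a graded module over `S = K[x₁, …, xₙ]` with its standard grading. -/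
structure IsGradedModule {K : Type u} [Field K] {n : ℕ} {N : Type*} [AddCommGroup N]
    [Module K N] [Module (MvPolynomial (Fin n) K) N] (𝒩 : ℕ → Submodule K N) : Prop where
  isInternal : DirectSum.IsInternal 𝒩
  smul_mem : ∀ (i j : ℕ) (p : MvPolynomial (Fin n) K) (x : N),
    p ∈ homogeneousSubmodule (Fin n) K i → x ∈ 𝒩 j → p • x ∈ 𝒩 (i + j)

/-- The Hilbert series `∑ⱼ (dim_K Nⱼ) tʲ`. It is used only for finitely generated graded
`K[x₁, …, xₙ]`-modules, all of whose components are finite dimensional. -/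
def hilbertSeries {K : Type u} [Field K] {N : Type*} [AddCommGroup N] [Module K N]
    (𝒩 : ℕ → Submodule K N) : PowerSeries ℤ :=
  PowerSeries.mk fun j => (Module.finrank K (𝒩 j) : ℤ)

/-- The Hilbert depth of a finitely generated graded module `M = ⨁ⱼ ℳ j` over
`S = K[x₁, …, xₙ]`: the largest depth of a finitely generated graded `S`-module `N` with
`H_N(t) = H_M(t)`. (Since `H_M(t)` has no terms of negative degree, neither has `N`, so gradings
by `ℕ` suffice; every finitely generated `S`-module has an isomorphic copy in the universe
of `K`.) -/
def hdepth {K : Type u} [Field K] (n : ℕ) {M : Type*} [AddCommGroup M] [Module K M]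
    (ℳ : ℕ → Submodule K M) : ℕ∞ :=
  sSup {r : ℕ∞ | ∃ (N : Type u) (_ : AddCommGroup N) (_ : Module K N)
    (_ : Module (MvPolynomial (Fin n) K) N) (_ : IsScalarTower K (MvPolynomial (Fin n) K) N)
    (𝒩 : ℕ → Submodule K N),
      Module.Finite (MvPolynomial (Fin n) K) N ∧ IsGradedModule (n := n) 𝒩 ∧
      hilbertSeries 𝒩 = hilbertSeries ℳ ∧ depth K n N = r}

section Ideals

variable {K : Type u} [Field K] {n : ℕ}

/-- `I` is generated by squarefree monomials `x_A = ∏_{j ∈ A} x_j`. -/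
def IsSquarefreeMonomialIdeal (I : Ideal (MvPolynomial (Fin n) K)) : Prop :=
  ∃ 𝒢 : Set (Finset (Fin n)), I = Ideal.span ((fun A => ∏ j ∈ A, X j) '' 𝒢)

/-- The standard grading of a homogeneous ideal `I`: the component of degree `j` consists of the
homogeneous polynomials of degree `j` in `I`. -/
def idealGrading (I : Ideal (MvPolynomial (Fin n) K)) (j : ℕ) : Submodule K I :=
  (homogeneousSubmodule (Fin n) K j).comap (I.subtype.restrictScalars K)

/-- The standard grading of `S/I` for a homogeneous ideal `I`: the component of degree `j`
consists of the residue classes of the homogeneous polynomials of degree `j`. -/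
def quotientGrading (I : Ideal (MvPolynomial (Fin n) K)) (j : ℕ) :
    Submodule K (MvPolynomial (Fin n) K ⧸ I) :=
  (homogeneousSubmodule (Fin n) K j).map (Ideal.Quotient.mkₐ K I).toLinearMap

/-- For a homogeneous ideal `I`, the graded ring `S/I` is Cohen–Macaulay if its Krull dimension
equals its depth. -/
def IsCohenMacaulayQuotient (I : Ideal (MvPolynomial (Fin n) K)) : Prop :=
  ringKrullDim (MvPolynomial (Fin n) K ⧸ I) =
    ((depth K n (MvPolynomial (Fin n) K ⧸ I) : ℕ∞) : WithBot ℕ∞)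

/-- For a monomial `m = x^a` and a set `Z` of variables, the `K`-linear map
`K[Z] → S/I`, `f ↦ m f mod I`. Its range is the subspace `m K[Z]` of `S/I`. -/
def stanleyMap (I : Ideal (MvPolynomial (Fin n) K)) (a : Fin n →₀ ℕ) (Z : Finset (Fin n)) :
    MvPolynomial Z K →ₗ[K] MvPolynomial (Fin n) K ⧸ I :=
  (Ideal.Quotient.mkₐ K I).toLinearMap ∘ₗ LinearMap.mulLeft K (monomial a (1 : K)) ∘ₗ
    (rename (Subtype.val : Z → Fin n)).toLinearMap

/-- A Stanley decomposition of `S/I`: a finite decomposition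
`S/I = ⨁ᵢ mᵢ K[Zᵢ]` as a direct sum of `K`-vector spaces, with monomials `mᵢ = x^(aᵢ)` and
sets of variables `Zᵢ`, where each `mᵢ K[Zᵢ]` is a free `K[Zᵢ]`-module (of rank one). -/
structure StanleyDecomposition (I : Ideal (MvPolynomial (Fin n) K)) where
  /-- the number of summands -/
  r : ℕ
  /-- the exponents of the monomials -/
  a : Fin r → Fin n →₀ ℕ
  /-- the sets of variables -/
  Z : Fin r → Finset (Fin n)
  free : ∀ i, Function.Injective (stanleyMap I (a i) (Z i))
  isInternal : DirectSum.IsInternal fun i => LinearMap.range (stanleyMap I (a i) (Z i))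

/-- The Stanley depth of `S/I`: the maximum over all Stanley decompositions of `minᵢ |Zᵢ|`. -/
def sdepthQuotient (I : Ideal (MvPolynomial (Fin n) K)) : ℕ∞ :=
  ⨆ D : StanleyDecomposition I, ⨅ i : Fin D.r, ((D.Z i).card : ℕ∞)

end Ideals

end HilbertDepth

end

/-! Let `d` be the largest size of a face, a set `F` of variables whose product is not in `I`.
Everything in (1) equals or is bounded by `d`. Restriction to the variables of a face gives a
surjection from `S/I` to a polynomial ring in `|F|` variables, so `d ≤ dim = depth ≤ hdepth`, the
equality being Cohen–Macaulayness. Conversely, hdepth sees only the Hilbert function. Over an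
infinite field a regular sequence of length `r` in `𝔪` can be replaced by `r` linear forms, which
force the sums of the Hilbert function up to degree `j` to grow at least like `j ^ r`; monomials
outside `I` are supported on faces, so for `S/I` these sums are at most `2 ^ n * (j + 1) ^ d`. Hence
`hdepth ≤ d`. The same face argument bounds sdepth, since each `Z i` of a Stanley decomposition is a
face.

For (2), a module with the Hilbert series of `I` and depth at least `d + 1` is constructed. After a
linear change of coordinates, `d` variables form a regular sequence on `S/I`. Setting them to zero
in the elements of `I` and extending back to `S` gives an ideal `J` with the same Hilbert function:
the sequence is regular on both quotients, with the same final quotient. As `J` is generated without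
these variables, they form a regular sequence on `J`, and one more variable can be appended because
`J/(ts)J` embeds in a domain. A spare variable exists because a nonzero `I` contains the product of
all variables, so `d < n`.

The key lemmas are `DepthGE.exists_linForm`, `depth_le_of_sum_finrank_le`,
`hilbertFun_span_killVars` and `regSeqMod_ideal`. -/

noncomputable section

namespace HilbertDepth

/-! ### Regular sequences modulo submodules of a fixed module -/

section RegularModulo

variable {R M : Type*} [CommRing R] [AddCommGroup M] [Module R M]

/-- `x` is a nonzerodivisor on `M ⧸ W`. -/
def RegMod (x : R) (W : Submodule R M) : Prop := ∀ m : M, x • m ∈ W → m ∈ W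

/-- The submodule `W + x M`. -/
def adjoinSMul (x : R) (W : Submodule R M) : Submodule R M :=
  W ⊔ LinearMap.range (LinearMap.lsmul R M x)

/-- `M ⧸ W` has no nonzero element annihilated by `𝔪`. -/
def NoSocle (𝔪 : Ideal R) (W : Submodule R M) : Prop :=
  ∀ m : M, (∀ a ∈ 𝔪, a • m ∈ W) → m ∈ W

/-- The list is a weakly regular sequence on `M ⧸ W`. -/
def RegSeqMod : List R → Submodule R M → Prop
  | [], _ => True
  | x :: xs, W => RegMod x W ∧ RegSeqMod xs (adjoinSMul x W)

/-- There is a weakly regular sequence of length `r` in `𝔪` on `M ⧸ W`. -/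
def DepthGE (𝔪 : Ideal R) : ℕ → Submodule R M → Prop
  | 0, _ => True
  | r + 1, W => ∃ x ∈ 𝔪, RegMod x W ∧ DepthGE 𝔪 r (adjoinSMul x W)

theorem mem_adjoinSMul {x : R} {W : Submodule R M} {m : M} :
    m ∈ adjoinSMul x W ↔ ∃ w ∈ W, ∃ n : M, w + x • n = m := by
  simp [adjoinSMul, Submodule.mem_sup]

theorem le_adjoinSMul (x : R) (W : Submodule R M) : W ≤ adjoinSMul x W := le_sup_left

theorem smul_mem_adjoinSMul (x : R) (W : Submodule R M) (n : M) : x • n ∈ adjoinSMul x W :=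
  mem_adjoinSMul.2 ⟨0, W.zero_mem, n, zero_add _⟩

theorem adjoinSMul_comm (x y : R) (W : Submodule R M) :
    adjoinSMul x (adjoinSMul y W) = adjoinSMul y (adjoinSMul x W) := by
  rw [adjoinSMul, adjoinSMul, adjoinSMul, adjoinSMul, sup_right_comm]

/-- The half of permutability that needs no Nakayama: if `x m ≡ y n` modulo `W`, regularity of `y`
makes `n` a multiple of `x`, and `x` cancels. -/
theorem RegMod.adjoinSMul_swap {x y : R} {W : Submodule R M} (hx : RegMod x W)
    (hxy : RegMod y (adjoinSMul x W)) : RegMod x (adjoinSMul y W) := by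
  intro m hm
  obtain ⟨w, hw, n, h⟩ := mem_adjoinSMul.1 hm
  have hn : n ∈ adjoinSMul x W := hxy n (mem_adjoinSMul.2 ⟨-w, W.neg_mem hw, m, by
    rw [← h]; abel⟩)
  obtain ⟨w', hw', n', rfl⟩ := mem_adjoinSMul.1 hn
  have : m - y • n' ∈ W := hx _ (by
    have : x • (m - y • n') = w + y • w' := by
      rw [smul_sub, ← h, smul_add, smul_comm x y]; abel
    rw [this]
    exact W.add_mem hw (W.smul_mem _ hw'))
  exact mem_adjoinSMul.2 ⟨_, this, n', by abel⟩

theorem RegMod.noSocle {𝔪 : Ideal R} {x : R} {W : Submodule R M} (hx : x ∈ 𝔪)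
    (h : RegMod x W) : NoSocle 𝔪 W := fun m hm => h m (hm x hx)

/-- An elementwise form of `Hom(R/𝔪, M/xM) ≅ Ext¹(R/𝔪, M) ≅ Hom(R/𝔪, M/yM)`: writing `x n ≡ y n'`
sends a socle element `n` modulo `y` to a socle element `n'` modulo `x`. -/
theorem NoSocle.swap {𝔪 : Ideal R} {x y : R} {W : Submodule R M} (hxm : x ∈ 𝔪)
    (hx : RegMod x W) (hy : RegMod y W) (h : NoSocle 𝔪 (adjoinSMul x W)) :
    NoSocle 𝔪 (adjoinSMul y W) := by
  intro n hn
  obtain ⟨w, hw, n', h'⟩ := mem_adjoinSMul.1 (hn x hxm)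
  have hn' : n' ∈ adjoinSMul x W := by
    refine h n' fun a ha => ?_
    obtain ⟨wa, hwa, na, hna⟩ := mem_adjoinSMul.1 (hn a ha)
    have : a • n' - x • na ∈ W := hy _ (by
      have : y • (a • n' - x • na) = x • wa - a • w := by
        have h1 : x • (a • n) = a • (x • n) := smul_comm _ _ _
        rw [← hna, ← h', smul_add, smul_add] at h1
        rw [smul_sub, smul_comm y a, smul_comm y x, sub_eq_sub_iff_add_eq_add, h1]
        abel
      rw [this]
      exact W.sub_mem (W.smul_mem _ hwa) (W.smul_mem _ hw))
    exact mem_adjoinSMul.2 ⟨_, this, na, by abel⟩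
  obtain ⟨w', hw', n'', rfl⟩ := mem_adjoinSMul.1 hn'
  have : n - y • n'' ∈ W := hx _ (by
    have : x • (n - y • n'') = w + y • w' := by
      rw [smul_sub, ← h', smul_add, smul_comm x y]; abel
    rw [this]
    exact W.add_mem hw (W.smul_mem _ hw'))
  exact mem_adjoinSMul.2 ⟨_, this, n'', by abel⟩

theorem DepthGE.noSocle {𝔪 : Ideal R} {r : ℕ} {W : Submodule R M} (h : DepthGE 𝔪 (r + 1) W) :
    NoSocle 𝔪 W := by
  obtain ⟨x, hx, h, -⟩ := h
  exact h.noSocle hx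

theorem RegSeqMod.depthGE {𝔪 : Ideal R} {rs : List R} (hrs : ∀ r ∈ rs, r ∈ 𝔪)
    {W : Submodule R M} (h : RegSeqMod rs W) : DepthGE 𝔪 rs.length W := by
  induction rs generalizing W with
  | nil => trivial
  | cons x xs ih =>
    exact ⟨x, hrs x (by simp), h.1, ih (fun r hr => hrs r (by simp [hr])) h.2⟩

theorem DepthGE.mono {𝔪 : Ideal R} {r s : ℕ} (hrs : r ≤ s) {W : Submodule R M}
    (h : DepthGE 𝔪 s W) : DepthGE 𝔪 r W := by
  induction r generalizing s W with
  | zero => trivial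
  | succ r ih =>
    obtain ⟨s, rfl⟩ := Nat.exists_eq_add_of_le' (show 1 ≤ s by omega)
    obtain ⟨x, hx, h1, h2⟩ := h
    exact ⟨x, hx, h1, ih (by omega) h2⟩

theorem regMod_iff_isSMulRegular {x : R} {W : Submodule R M} :
    RegMod x W ↔ IsSMulRegular (M ⧸ W) x := by
  rw [isSMulRegular_iff_right_eq_zero_of_smul]
  constructor
  · intro h m hm
    obtain ⟨m, rfl⟩ := Submodule.Quotient.mk_surjective _ m
    rw [← Submodule.Quotient.mk_smul, Submodule.Quotient.mk_eq_zero] at hm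
    exact (Submodule.Quotient.mk_eq_zero _).2 (h m hm)
  · intro h m hm
    rw [← Submodule.Quotient.mk_eq_zero]
    exact h _ (by rwa [← Submodule.Quotient.mk_smul, Submodule.Quotient.mk_eq_zero])

open scoped Pointwise in
-- Bridge to the usual notion. Staying inside one module `M`, instead of iterating quotients, makes
-- `W + xM + yM` visibly symmetric in `x` and `y`.
theorem regSeqMod_iff_isWeaklyRegular {rs : List R} {W : Submodule R M} :
    RegSeqMod rs W ↔ RingTheory.Sequence.IsWeaklyRegular (M ⧸ W) rs := by
  induction rs generalizing W with
  | nil => simp [RegSeqMod]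
  | cons x xs ih =>
    rw [RingTheory.Sequence.isWeaklyRegular_cons_iff, RegSeqMod, ih, regMod_iff_isSMulRegular]
    refine and_congr_right' ?_
    have h : (x • (⊤ : Submodule R (M ⧸ W))) = (adjoinSMul x W).map W.mkQ := by
      ext m
      obtain ⟨m, rfl⟩ := Submodule.Quotient.mk_surjective _ m
      rw [Submodule.mem_smul_pointwise_iff_exists]
      constructor
      · rintro ⟨n, -, hn⟩
        obtain ⟨n, rfl⟩ := Submodule.Quotient.mk_surjective _ n
        exact ⟨x • n, smul_mem_adjoinSMul _ _ _, hn⟩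
      · rintro ⟨n, hn, h⟩
        obtain ⟨w, hw, n, rfl⟩ := mem_adjoinSMul.1 hn
        refine ⟨W.mkQ n, trivial, ?_⟩
        change _ = Submodule.Quotient.mk m
        rw [← h, map_add, map_smul]
        simp [hw]
    exact (LinearEquiv.isWeaklyRegular_congr ((Submodule.quotEquivOfEq _ _ h).trans
      (Submodule.quotientQuotientEquivQuotient W _ (le_adjoinSMul x W))) xs).symm

end RegularModulo

/-! ### Replacing regular sequences by linear forms -/

section LinearForms

variable {K : Type u} [Field K] {n : ℕ}

/-- The linear form `∑ᵢ vᵢ xᵢ`. -/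
def linForm (K : Type u) [Field K] (n : ℕ) : (Fin n → K) →ₗ[K] MvPolynomial (Fin n) K :=
  Fintype.linearCombination K X

theorem linForm_apply (v : Fin n → K) : linForm K n v = ∑ i, v i • X i :=
  Fintype.linearCombination_apply K X v

theorem linForm_single (i : Fin n) : linForm K n (Pi.single i 1) = X i := by
  rw [linForm, Fintype.linearCombination_apply_single, one_smul]

theorem linForm_mem_homogeneousSubmodule (v : Fin n → K) :
    linForm K n v ∈ homogeneousSubmodule (Fin n) K 1 := by
  rw [linForm_apply]
  exact Submodule.sum_mem _ fun i _ => Submodule.smul_mem _ _ (isHomogeneous_X K i)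

theorem X_mem_maxIdeal (i : Fin n) : (X i : MvPolynomial (Fin n) K) ∈ maxIdeal K n :=
  Ideal.subset_span ⟨i, rfl⟩

theorem linForm_mem_maxIdeal (v : Fin n → K) : linForm K n v ∈ maxIdeal K n := by
  rw [linForm_apply]
  refine Ideal.sum_mem _ fun i _ => ?_
  rw [MvPolynomial.smul_eq_C_mul]
  exact Ideal.mul_mem_left _ _ (X_mem_maxIdeal i)

variable {M : Type*} [AddCommGroup M] [Module (MvPolynomial (Fin n) K) M]
  [Module.Finite (MvPolynomial (Fin n) K) M] [Infinite K]

/-- Prime avoidance by linear forms. -/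
theorem exists_linForm_regMod {ι : Type*} [Finite ι]
    (W : ι → Submodule (MvPolynomial (Fin n) K) M) (hW : ∀ i, NoSocle (maxIdeal K n) (W i)) :
    ∃ v : Fin n → K, ∀ i, RegMod (linForm K n v) (W i) := by
  have hfin : ∀ i, Finite (associatedPrimes (MvPolynomial (Fin n) K) (M ⧸ W i)) :=
    fun i => associatedPrimes.finite _ _
  let U : (Σ i, associatedPrimes (MvPolynomial (Fin n) K) (M ⧸ W i)) → Submodule K (Fin n → K) :=
    fun P => (Submodule.restrictScalars K P.2.1).comap (linForm K n)
  -- An associated prime containing every variable would contain `𝔪`, and the element it annihilates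
  -- would be a nonzero socle element.
  have hU : ∀ P, U P ≠ ⊤ := by
    rintro ⟨i, P, hP⟩ htop
    have hle : maxIdeal K n ≤ P := by
      refine Ideal.span_le.2 ?_
      rintro _ ⟨j, rfl⟩
      have : (Pi.single j 1 : Fin n → K) ∈ U ⟨i, P, hP⟩ := htop ▸ trivial
      have h2 : linForm K n (Pi.single j 1) ∈ P := this
      rwa [linForm_single] at h2
    rw [AssociatedPrimes.mem_iff, isAssociatedPrime_iff] at hP
    obtain ⟨hprime, x, hx⟩ := hP
    obtain ⟨m, rfl⟩ := Submodule.Quotient.mk_surjective _ x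
    have hm : m ∈ W i := hW i m fun a ha => by
      have := hle ha
      rw [hx, Submodule.mem_colon_singleton, ← Submodule.Quotient.mk_smul, Submodule.mem_bot,
        Submodule.Quotient.mk_eq_zero] at this
      exact this
    apply hprime.ne_top
    rw [hx, (Submodule.Quotient.mk_eq_zero _).2 hm, Ideal.eq_top_iff_one]
    simp [Submodule.mem_colon_singleton]
  -- A vector space over an infinite field is not a finite union of proper subspaces.
  have hne : (⋃ P, (U P : Set (Fin n → K))) ≠ Set.univ := fun h => by
    obtain ⟨P, hP⟩ := Subspace.exists_eq_top_of_iUnion_eq_univ h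
    exact hU P hP
  obtain ⟨v, hv⟩ := (Set.ne_univ_iff_exists_notMem _).1 hne
  refine ⟨v, fun i => ?_⟩
  by_contra hreg
  have hz : linForm K n v ∈ {r : MvPolynomial (Fin n) K | ∃ x : M ⧸ W i, x ≠ 0 ∧ r • x = 0} := by
    rw [RegMod] at hreg
    push Not at hreg
    obtain ⟨m, h1, h2⟩ := hreg
    refine ⟨Submodule.Quotient.mk m, ?_, ?_⟩
    · rwa [ne_eq, Submodule.Quotient.mk_eq_zero]
    · rwa [← Submodule.Quotient.mk_smul, Submodule.Quotient.mk_eq_zero]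
  rw [← biUnion_associatedPrimes_eq_zero_divisors, Set.mem_iUnion₂] at hz
  obtain ⟨P, hP, hvP⟩ := hz
  exact hv (Set.mem_iUnion.2 ⟨⟨i, P, hP⟩, hvP⟩)

/-- Any regular `y` can start the sequence, not just the given `x`. Since `x` and `y` have the same
socle behaviour, one linear form `z` is regular modulo both. Induction modulo `x` removes `z`; then,
modulo `z`, where `x` and `y` are still regular, induction removes `y`. -/
theorem DepthGE.adjoinSMul {r : ℕ} {W : Submodule (MvPolynomial (Fin n) K) M}
    {y : MvPolynomial (Fin n) K} (hym : y ∈ maxIdeal K n) (hy : RegMod y W)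
    (h : DepthGE (maxIdeal K n) (r + 1) W) :
    DepthGE (maxIdeal K n) r (adjoinSMul y W) := by
  induction r generalizing W y with
  | zero => trivial
  | succ r ih =>
    obtain ⟨x, hxm, hx, hD⟩ := h
    obtain ⟨v, hv⟩ := exists_linForm_regMod
      ![HilbertDepth.adjoinSMul x W, HilbertDepth.adjoinSMul y W] (by
        intro i
        fin_cases i
        · exact hD.noSocle
        · exact NoSocle.swap hxm hx hy hD.noSocle)
    have hz1 : RegMod (linForm K n v) (HilbertDepth.adjoinSMul x W) := hv 0
    have hz2 : RegMod (linForm K n v) (HilbertDepth.adjoinSMul y W) := hv 1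
    have hzm := linForm_mem_maxIdeal v
    have h1 := ih hzm hz1 hD
    rw [adjoinSMul_comm] at h1
    have h2 := ih hym (hy.adjoinSMul_swap hz2) ⟨x, hxm, hx.adjoinSMul_swap hz1, h1⟩
    rw [adjoinSMul_comm] at h2
    exact ⟨_, hzm, hz2, h2⟩

theorem DepthGE.exists_linForm {r : ℕ} {W : Submodule (MvPolynomial (Fin n) K) M}
    (h : DepthGE (maxIdeal K n) r W) :
    ∃ v : Fin r → Fin n → K, RegSeqMod (List.ofFn fun i => linForm K n (v i)) W := by
  induction r generalizing W with
  | zero => exact ⟨Fin.elim0, by simp [RegSeqMod]⟩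
  | succ r ih =>
    obtain ⟨v, hv⟩ := exists_linForm_regMod (fun _ : Unit => W) fun _ => h.noSocle
    obtain ⟨vs, hvs⟩ := ih (h.adjoinSMul (linForm_mem_maxIdeal v) (hv ()))
    refine ⟨Fin.cons v vs, ?_⟩
    rw [List.ofFn_succ]
    exact ⟨hv (), by simpa using hvs⟩

end LinearForms

/-! ### Projections onto graded components -/

section Projections

variable {K : Type*} [Field K] {N : Type*} [AddCommGroup N] [Module K N]

/-- The maps `p j` are the projections to the components of a direct sum decomposition
`N = ⨁ⱼ 𝒩 j`. -/
structure IsProjFamily (𝒩 : ℕ → Submodule K N) (p : ℕ → N →ₗ[K] N) : Prop where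
  mem : ∀ j x, p j x ∈ 𝒩 j
  of_mem : ∀ j, ∀ x ∈ 𝒩 j, p j x = x
  of_mem_ne : ∀ i j, i ≠ j → ∀ x ∈ 𝒩 i, p j x = 0
  sum : ∀ x, ∃ s : Finset ℕ, ∑ i ∈ s, p i x = x

theorem IsProjFamily.isInternal {𝒩 : ℕ → Submodule K N} {p : ℕ → N →ₗ[K] N}
    (h : IsProjFamily 𝒩 p) : DirectSum.IsInternal 𝒩 := by
  classical
  constructor
  · rw [injective_iff_map_eq_zero]
    intro a ha
    ext j
    have h1 : ∀ b : DirectSum ℕ fun i => 𝒩 i,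
        p j (DirectSum.coeAddMonoidHom 𝒩 b) = (b j : N) := by
      intro b
      induction b using DirectSum.induction_on with
      | zero => simp
      | of i x =>
        rw [DirectSum.coeAddMonoidHom_of]
        rcases eq_or_ne i j with rfl | hij
        · rw [h.of_mem _ _ x.2, DirectSum.of_eq_same]
        · rw [h.of_mem_ne _ _ hij _ x.2, DirectSum.of_eq_of_ne _ _ _ hij.symm]
          simp
      | add x y hx hy => simp [hx, hy]
    rw [← h1, ha]
    simp
  · intro x
    obtain ⟨s, hs⟩ := h.sum x
    refine ⟨∑ i ∈ s, DirectSum.of (fun i => 𝒩 i) i ⟨p i x, h.mem i x⟩, ?_⟩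
    simp [hs]

theorem exists_isProjFamily {𝒩 : ℕ → Submodule K N} (h : DirectSum.IsInternal 𝒩) :
    ∃ p, IsProjFamily 𝒩 p := by
  classical
  let := h.chooseDecomposition
  refine ⟨fun j => (𝒩 j).subtype ∘ₗ DirectSum.component K ℕ (fun i => 𝒩 i) j ∘ₗ
    (DirectSum.decomposeLinearEquiv 𝒩).toLinearMap, ?_, ?_, ?_, ?_⟩
  · intro j x
    exact Submodule.coe_mem _
  · intro j x hx
    exact DirectSum.decompose_of_mem_same 𝒩 hx
  · intro i j hij x hx
    exact DirectSum.decompose_of_mem_ne 𝒩 hx hij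
  · intro x
    exact ⟨_, DirectSum.sum_support_decompose 𝒩 x⟩

theorem IsProjFamily.ext {𝒩 : ℕ → Submodule K N} {p : ℕ → N →ₗ[K] N} (h : IsProjFamily 𝒩 p)
    {N' : Type*} [AddCommGroup N'] [Module K N'] {f g : N →ₗ[K] N'}
    (hfg : ∀ i, ∀ x ∈ 𝒩 i, f x = g x) : f = g := by
  ext x
  obtain ⟨s, hs⟩ := h.sum x
  rw [← hs, map_sum, map_sum]
  exact Finset.sum_congr rfl fun i _ => hfg i _ (h.mem i x)

theorem finrank_map_add_finrank_inf_ker {N' : Type*} [AddCommGroup N'] [Module K N']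
    (A : Submodule K N) [FiniteDimensional K A] (f : N →ₗ[K] N') :
    Module.finrank K (A.map f) + Module.finrank K (A ⊓ LinearMap.ker f : Submodule K N) =
      Module.finrank K A := by
  rw [← (f.domRestrict A).finrank_range_add_finrank_ker, LinearMap.range_domRestrict,
    LinearMap.ker_domRestrict, ← Submodule.finrank_map_subtype_eq A, Submodule.map_comap_subtype]

end Projections

/-! ### Hilbert functions of graded quotients -/

section Codimension

variable {K : Type u} [Field K] {n : ℕ} {N : Type*} [AddCommGroup N] [Module K N]
  [Module (MvPolynomial (Fin n) K) N] [IsScalarTower K (MvPolynomial (Fin n) K) N]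
  {𝒩 : ℕ → Submodule K N} {p : ℕ → N →ₗ[K] N}

/-- `W` is a graded submodule with respect to the projections `p`. -/
def IsGradedSub (p : ℕ → N →ₗ[K] N) (W : Submodule (MvPolynomial (Fin n) K) N) : Prop :=
  ∀ j, ∀ x ∈ W, p j x ∈ W

/-- The Hilbert function of `N ⧸ W`. -/
def hilbertFun (𝒩 : ℕ → Submodule K N) (W : Submodule (MvPolynomial (Fin n) K) N) (j : ℕ) : ℤ :=
  Module.finrank K (𝒩 j) - Module.finrank K (𝒩 j ⊓ W.restrictScalars K : Submodule K N)

theorem IsProjFamily.proj_smul (hp : IsProjFamily 𝒩 p) (h : IsGradedModule (n := n) 𝒩)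
    {i : ℕ} {s : MvPolynomial (Fin n) K} (hs : s ∈ homogeneousSubmodule (Fin n) K i)
    (j : ℕ) (x : N) : p (i + j) (s • x) = s • p j x := by
  have : p (i + j) ∘ₗ (LinearMap.lsmul (MvPolynomial (Fin n) K) N s).restrictScalars K =
      (LinearMap.lsmul (MvPolynomial (Fin n) K) N s).restrictScalars K ∘ₗ p j := by
    refine hp.ext fun k x hx => ?_
    change p (i + j) (s • x) = s • p j x
    rcases eq_or_ne k j with rfl | hkj
    · rw [hp.of_mem _ _ hx, hp.of_mem _ _ (h.smul_mem _ _ _ _ hs hx)]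
    · rw [hp.of_mem_ne _ _ hkj _ hx, hp.of_mem_ne _ _ (by omega) _ (h.smul_mem _ _ _ _ hs hx),
        smul_zero]
  exact LinearMap.congr_fun this x

theorem IsProjFamily.proj_smul_of_lt (hp : IsProjFamily 𝒩 p) (h : IsGradedModule (n := n) 𝒩)
    {i : ℕ} {s : MvPolynomial (Fin n) K} (hs : s ∈ homogeneousSubmodule (Fin n) K i)
    {j : ℕ} (hj : j < i) (x : N) : p j (s • x) = 0 := by
  have : p j ∘ₗ (LinearMap.lsmul (MvPolynomial (Fin n) K) N s).restrictScalars K = 0 := by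
    refine hp.ext fun k x hx => ?_
    exact hp.of_mem_ne _ _ (by omega) _ (h.smul_mem _ _ _ _ hs hx)
  exact LinearMap.congr_fun this x

open scoped Pointwise in
-- The products `x^a g`, with `g` in a finite generating set, span `N`. The `g` need not be
-- homogeneous, but `x^a g` has no component in degree `j` once `deg a > j`, leaving finitely many.
theorem IsGradedModule.finiteDimensional [Module.Finite (MvPolynomial (Fin n) K) N]
    (h : IsGradedModule (n := n) 𝒩) (j : ℕ) : FiniteDimensional K (𝒩 j) := by
  obtain ⟨p, hp⟩ := exists_isProjFamily h.isInternal
  obtain ⟨G, hG⟩ := Module.Finite.fg_top (R := MvPolynomial (Fin n) K) (M := N)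
  have hA : {a : Fin n →₀ ℕ | a.degree ≤ j}.Finite := Finsupp.finite_of_degree_le j
  let T : Set N := Set.image2 (fun (a : Fin n →₀ ℕ) g => monomial a (1 : K) • g)
    {a : Fin n →₀ ℕ | a.degree ≤ j} G
  have hT : T.Finite := hA.image2 _ G.finite_toSet
  have : FiniteDimensional K (Submodule.span K T) := FiniteDimensional.span_of_finite K hT
  have hspan : Submodule.span K (Set.range fun a : Fin n →₀ ℕ => monomial a (1 : K)) = ⊤ := by
    have := (basisMonomials (Fin n) K).span_eq
    rwa [coe_basisMonomials] at this
  have htop := Submodule.span_smul_of_span_eq_top hspan (G : Set N)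
  rw [hG] at htop
  have hle : 𝒩 j ≤ (Submodule.span K T).map (p j) := by
    have key : ∀ x ∈ Submodule.span K
        ((Set.range fun a : Fin n →₀ ℕ => monomial a (1 : K)) • (G : Set N)),
        p j x ∈ (Submodule.span K T).map (p j) := by
      intro x hx
      induction hx using Submodule.span_induction with
      | mem x hx =>
        obtain ⟨_, ⟨a, rfl⟩, g, hg, rfl⟩ := hx
        rcases le_or_gt a.degree j with ha | ha
        · exact ⟨_, Submodule.subset_span ⟨a, ha, g, hg, rfl⟩, rfl⟩
        · change p j (monomial a (1 : K) • g) ∈ _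
          rw [hp.proj_smul_of_lt h (isHomogeneous_monomial _ rfl) ha]
          exact zero_mem _
      | zero => rw [map_zero]; exact zero_mem _
      | add x y _ _ hx hy => rw [map_add]; exact add_mem hx hy
      | smul c x _ hx => rw [map_smul]; exact Submodule.smul_mem _ _ hx
    intro x hx
    rw [← hp.of_mem j x hx]
    exact key x (htop ▸ trivial)
  exact Submodule.finiteDimensional_of_le hle

variable {l : MvPolynomial (Fin n) K} {W : Submodule (MvPolynomial (Fin n) K) N}

theorem IsGradedSub.adjoinSMul (hp : IsProjFamily 𝒩 p) (h : IsGradedModule (n := n) 𝒩)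
    (hl : l ∈ homogeneousSubmodule (Fin n) K 1) (hW : IsGradedSub p W) :
    IsGradedSub p (adjoinSMul l W) := by
  intro j x hx
  obtain ⟨w, hw, y, rfl⟩ := mem_adjoinSMul.1 hx
  rw [map_add]
  refine add_mem (le_adjoinSMul _ _ (hW j w hw)) ?_
  rcases j with _ | j
  · rw [hp.proj_smul_of_lt h hl one_pos]
    exact zero_mem _
  · rw [add_comm j 1, hp.proj_smul h hl]
    exact smul_mem_adjoinSMul _ _ _

theorem hilbertFun_adjoinSMul_zero (hp : IsProjFamily 𝒩 p) (h : IsGradedModule (n := n) 𝒩)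
    (hl : l ∈ homogeneousSubmodule (Fin n) K 1) (hW : IsGradedSub p W) :
    hilbertFun 𝒩 (adjoinSMul l W) 0 = hilbertFun 𝒩 W 0 := by
  have : 𝒩 0 ⊓ (HilbertDepth.adjoinSMul l W).restrictScalars K = 𝒩 0 ⊓ W.restrictScalars K := by
    refine le_antisymm ?_ (inf_le_inf_left _ (le_adjoinSMul l W))
    rintro x ⟨hx, hx'⟩
    refine ⟨hx, ?_⟩
    obtain ⟨w, hw, y, rfl⟩ := mem_adjoinSMul.1 hx'
    rw [← hp.of_mem _ _ hx, map_add, hp.proj_smul_of_lt h hl one_pos, add_zero]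
    exact hW _ _ hw
  rw [hilbertFun, hilbertFun, this]

/-- Dimension count in `0 → (N/W)(-1) → N/W → N/(W + lN) → 0`, exact because `l` is regular of
degree one. -/
theorem hilbertFun_adjoinSMul_succ (hp : IsProjFamily 𝒩 p) (h : IsGradedModule (n := n) 𝒩)
    [∀ j, FiniteDimensional K (𝒩 j)]
    (hl : l ∈ homogeneousSubmodule (Fin n) K 1) (hW : IsGradedSub p W) (hreg : RegMod l W)
    (j : ℕ) :
    hilbertFun 𝒩 (adjoinSMul l W) (j + 1) = hilbertFun 𝒩 W (j + 1) - hilbertFun 𝒩 W j := by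
  let q : N →ₗ[K] N ⧸ W.restrictScalars K := (W.restrictScalars K).mkQ
  let f : N →ₗ[K] N ⧸ W.restrictScalars K :=
    q ∘ₗ (LinearMap.lsmul (MvPolynomial (Fin n) K) N l).restrictScalars K
  let B : Submodule K N := 𝒩 (j + 1) ⊓ (HilbertDepth.adjoinSMul l W).restrictScalars K
  have hfx : ∀ x, f x = q (l • x) := fun _ => rfl
  have hq : ∀ x, q x = 0 ↔ x ∈ W := fun x => Submodule.Quotient.mk_eq_zero _
  have : FiniteDimensional K B := Submodule.finiteDimensional_inf_left _ _
  have h1 := finrank_map_add_finrank_inf_ker (𝒩 j) f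
  have h2 := finrank_map_add_finrank_inf_ker B q
  have e1 : 𝒩 j ⊓ LinearMap.ker f = 𝒩 j ⊓ W.restrictScalars K := by
    congr 1
    ext x
    rw [LinearMap.mem_ker, hfx, hq]
    exact ⟨hreg x, fun hx => W.smul_mem _ hx⟩
  have e2 : B ⊓ LinearMap.ker q = 𝒩 (j + 1) ⊓ W.restrictScalars K := by
    ext x
    simp only [Submodule.mem_inf, LinearMap.mem_ker, hq, B, Submodule.restrictScalars_mem]
    exact ⟨fun hx => ⟨hx.1.1, hx.2⟩, fun hx => ⟨⟨hx.1, le_adjoinSMul _ _ hx.2⟩, hx.2⟩⟩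
  have e3 : B.map q = (𝒩 j).map f := by
    apply le_antisymm
    · rintro _ ⟨x, ⟨hx, hx'⟩, rfl⟩
      obtain ⟨w, hw, y, rfl⟩ := mem_adjoinSMul.1 hx'
      refine ⟨p j y, hp.mem _ _, ?_⟩
      rw [← hp.of_mem _ _ hx, map_add, map_add, (hq _).2 (hW _ _ hw), zero_add, hfx, add_comm j 1,
        hp.proj_smul h hl]
    · rintro _ ⟨x, hx, rfl⟩
      refine ⟨l • x, ⟨?_, smul_mem_adjoinSMul _ _ _⟩, rfl⟩
      rw [add_comm j 1]
      exact h.smul_mem _ _ _ _ hl hx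
  rw [e1] at h1
  rw [e2, e3] at h2
  simp only [hilbertFun]
  change (_ : ℤ) - (Module.finrank K B : ℤ) = _
  omega

theorem hilbertFun_nonneg [∀ j, FiniteDimensional K (𝒩 j)] (j : ℕ) : 0 ≤ hilbertFun 𝒩 W j := by
  rw [hilbertFun, sub_nonneg, Nat.cast_le]
  exact Submodule.finrank_mono inf_le_left

/-- Undoing the quotient by a regular linear form multiplies the Hilbert series by `1/(1 - t)`. The
initial degree `j₀` survives every quotient, so the series dominates `t^j₀ / (1 - t)^r`
coefficientwise. -/
theorem multichoose_le_hilbertFun (hp : IsProjFamily 𝒩 p) (h : IsGradedModule (n := n) 𝒩)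
    [∀ j, FiniteDimensional K (𝒩 j)] {rs : List (MvPolynomial (Fin n) K)}
    (hrs : ∀ r ∈ rs, r ∈ homogeneousSubmodule (Fin n) K 1)
    (hW : IsGradedSub p W) (hreg : RegSeqMod rs W) {j₀ : ℕ}
    (h0 : ∀ j < j₀, hilbertFun 𝒩 W j = 0) (h1 : 1 ≤ hilbertFun 𝒩 W j₀) (j : ℕ) :
    (Nat.multichoose rs.length j : ℤ) ≤ hilbertFun 𝒩 W (j₀ + j) := by
  induction rs generalizing W j with
  | nil =>
    rcases j with _ | j
    · simpa using h1
    · simpa using hilbertFun_nonneg _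
  | cons l rs ih =>
    have hl := hrs l (by simp)
    have h0' : ∀ j < j₀, hilbertFun 𝒩 (adjoinSMul l W) j = 0 := by
      intro j hj
      rcases j with _ | j
      · rw [hilbertFun_adjoinSMul_zero hp h hl hW, h0 _ hj]
      · rw [hilbertFun_adjoinSMul_succ hp h hl hW hreg.1, h0 _ hj, h0 _ (by omega), sub_zero]
    have h1' : 1 ≤ hilbertFun 𝒩 (adjoinSMul l W) j₀ := by
      rcases j₀ with _ | j
      · rwa [hilbertFun_adjoinSMul_zero hp h hl hW]
      · rwa [hilbertFun_adjoinSMul_succ hp h hl hW hreg.1, h0 j (by omega), sub_zero]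
    have key := ih (fun r hr => hrs r (by simp [hr])) (hW.adjoinSMul hp h hl) hreg.2 h0' h1'
    induction j with
    | zero => simpa using h1
    | succ j ihj =>
      have := key (j + 1)
      rw [← add_assoc, hilbertFun_adjoinSMul_succ hp h hl hW hreg.1] at this
      rw [List.length_cons, Nat.multichoose_succ_succ, ← add_assoc]
      rw [List.length_cons] at ihj
      push_cast
      linarith

/-- Both Hilbert series are that of the common final quotient divided by the same power of `1 - t`.
-/
theorem hilbertFun_eq_of_regSeqMod (hp : IsProjFamily 𝒩 p) (h : IsGradedModule (n := n) 𝒩)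
    [∀ j, FiniteDimensional K (𝒩 j)] {rs : List (MvPolynomial (Fin n) K)}
    (hrs : ∀ r ∈ rs, r ∈ homogeneousSubmodule (Fin n) K 1)
    {W' : Submodule (MvPolynomial (Fin n) K) N}
    (hW : IsGradedSub p W) (hW' : IsGradedSub p W')
    (hreg : RegSeqMod rs W) (hreg' : RegSeqMod rs W')
    (heq : rs.foldl (fun V x => adjoinSMul x V) W = rs.foldl (fun V x => adjoinSMul x V) W')
    (j : ℕ) : hilbertFun 𝒩 W j = hilbertFun 𝒩 W' j := by
  induction rs generalizing W W' j with
  | nil => rw [show W = W' from heq]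
  | cons l rs ih =>
    have hl := hrs l (by simp)
    have key := ih (fun r hr => hrs r (by simp [hr])) (hW.adjoinSMul hp h hl)
      (hW'.adjoinSMul hp h hl) hreg.2 hreg'.2 heq
    induction j with
    | zero =>
      have := key 0
      rwa [hilbertFun_adjoinSMul_zero hp h hl hW, hilbertFun_adjoinSMul_zero hp h hl hW'] at this
    | succ j ihj =>
      have := key (j + 1)
      rw [hilbertFun_adjoinSMul_succ hp h hl hW hreg.1,
        hilbertFun_adjoinSMul_succ hp h hl hW' hreg'.1] at this
      linarith

end Codimension

/-! ### Gradings induced on quotients and subspaces -/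

section TransferProjections

variable {K : Type*} [Field K] {N N' : Type*} [AddCommGroup N] [Module K N]
  [AddCommGroup N'] [Module K N'] {𝒩 : ℕ → Submodule K N} {p : ℕ → N →ₗ[K] N}

theorem IsProjFamily.exists_map (hp : IsProjFamily 𝒩 p) (f : N →ₗ[K] N')
    (hf : Function.Surjective f) (hker : ∀ j x, f x = 0 → f (p j x) = 0) :
    ∃ p', IsProjFamily (fun j => (𝒩 j).map f) p' := by
  let p' : ℕ → N' →ₗ[K] N' := fun j =>
    (LinearMap.ker f).liftQ (f ∘ₗ p j) (fun x hx => hker j x hx) ∘ₗ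
      (f.quotKerEquivOfSurjective hf).symm.toLinearMap
  have hp' : ∀ j x, p' j (f x) = f (p j x) := by
    intro j x
    have : (f.quotKerEquivOfSurjective hf).symm (f x) = Submodule.Quotient.mk x := by
      rw [LinearEquiv.symm_apply_eq]; rfl
    change (LinearMap.ker f).liftQ (f ∘ₗ p j) (fun x hx => hker j x hx) ((f.quotKerEquivOfSurjective hf).symm (f x)) = _
    rw [this]
    rfl
  refine ⟨p', ?_, ?_, ?_, ?_⟩
  · intro j x
    obtain ⟨x, rfl⟩ := hf x
    exact ⟨p j x, hp.mem j x, (hp' j x).symm⟩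
  · rintro j _ ⟨x, hx, rfl⟩
    rw [hp', hp.of_mem j x hx]
  · rintro i j hij _ ⟨x, hx, rfl⟩
    rw [hp', hp.of_mem_ne i j hij x hx, map_zero]
  · intro x
    obtain ⟨x, rfl⟩ := hf x
    obtain ⟨s, hs⟩ := hp.sum x
    refine ⟨s, ?_⟩
    conv_rhs => rw [← hs]
    rw [map_sum]
    exact Finset.sum_congr rfl fun i _ => hp' i x

theorem IsProjFamily.exists_comap (hp : IsProjFamily 𝒩 p) (f : N' →ₗ[K] N)
    (hf : Function.Injective f) (hrange : ∀ j x, ∃ y, f y = p j (f x)) :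
    ∃ p', IsProjFamily (fun j => (𝒩 j).comap f) p' := by
  let p' : ℕ → N' →ₗ[K] N' := fun j =>
    (LinearEquiv.ofInjective f hf).symm.toLinearMap ∘ₗ
      LinearMap.codRestrict (LinearMap.range f) (p j ∘ₗ f) (fun x => hrange j x)
  have hp' : ∀ j x, f (p' j x) = p j (f x) := by
    intro j x
    have := (LinearEquiv.ofInjective f hf).apply_symm_apply
      (LinearMap.codRestrict (LinearMap.range f) (p j ∘ₗ f) (fun x => hrange j x) x)
    exact congrArg Subtype.val this
  refine ⟨p', ?_, ?_, ?_, ?_⟩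
  · intro j x
    change f (p' j x) ∈ 𝒩 j
    rw [hp']
    exact hp.mem _ _
  · intro j x hx
    exact hf (by rw [hp', hp.of_mem j _ hx])
  · intro i j hij x hx
    exact hf (by rw [hp', hp.of_mem_ne i j hij _ hx, map_zero])
  · intro x
    obtain ⟨s, hs⟩ := hp.sum (f x)
    refine ⟨s, hf ?_⟩
    rw [map_sum]
    exact (Finset.sum_congr rfl fun i _ => hp' i x).trans hs

end TransferProjections

/-! ### Graded ideals and polynomial growth of Hilbert functions -/

section PolynomialRing

variable {K : Type u} [Field K] {n : ℕ}

theorem isProjFamily_homogeneousComponent :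
    IsProjFamily (homogeneousSubmodule (Fin n) K) homogeneousComponent where
  mem j x := homogeneousComponent_mem j x
  of_mem j x hx := by rw [homogeneousComponent_of_mem hx, if_pos rfl]
  of_mem_ne i j hij x hx := by rw [homogeneousComponent_of_mem hx, if_neg hij.symm]
  sum x := ⟨_, sum_homogeneousComponent x⟩

theorem isGradedModule_homogeneousSubmodule :
    IsGradedModule (K := K) (n := n) (homogeneousSubmodule (Fin n) K) where
  isInternal := isProjFamily_homogeneousComponent.isInternal
  smul_mem _ _ _ _ hp hx := IsHomogeneous.mul hp hx

instance (j : ℕ) : FiniteDimensional K (homogeneousSubmodule (Fin n) K j) :=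
  isGradedModule_homogeneousSubmodule.finiteDimensional j

theorem isGradedSub_span {G : Set (MvPolynomial (Fin n) K)}
    (hG : ∀ g ∈ G, ∀ j, homogeneousComponent j g ∈ Ideal.span G) :
    IsGradedSub homogeneousComponent (Ideal.span G) := by
  intro j x hx
  induction hx using Submodule.span_induction generalizing j with
  | mem x hx => exact hG x hx j
  | zero => rw [map_zero]; exact zero_mem _
  | add x y _ _ hx hy => rw [map_add]; exact add_mem (hx j) (hy j)
  | smul s x _ hx =>
    rw [← sum_homogeneousComponent s, Finset.sum_smul, map_sum]
    refine Submodule.sum_mem _ fun i _ => ?_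
    rcases lt_or_ge j i with hij | hij
    · rw [isProjFamily_homogeneousComponent.proj_smul_of_lt isGradedModule_homogeneousSubmodule
        (homogeneousComponent_mem i s) hij]
      exact zero_mem _
    · obtain ⟨k, rfl⟩ := Nat.exists_eq_add_of_le hij
      rw [isProjFamily_homogeneousComponent.proj_smul isGradedModule_homogeneousSubmodule
        (homogeneousComponent_mem i s)]
      exact Submodule.smul_mem _ _ (hx k)

theorem isGradedSub_span_of_isHomogeneous {G : Set (MvPolynomial (Fin n) K)}
    (hG : ∀ g ∈ G, ∃ i, g ∈ homogeneousSubmodule (Fin n) K i) :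
    IsGradedSub homogeneousComponent (Ideal.span G) := by
  refine isGradedSub_span fun g hg j => ?_
  obtain ⟨i, hi⟩ := hG g hg
  rcases eq_or_ne i j with rfl | hij
  · rw [isProjFamily_homogeneousComponent.of_mem _ _ hi]
    exact Ideal.subset_span hg
  · rw [isProjFamily_homogeneousComponent.of_mem_ne _ _ hij _ hi]
    exact zero_mem _

theorem prod_X_mem_homogeneousSubmodule (A : Finset (Fin n)) :
    (∏ j ∈ A, X j : MvPolynomial (Fin n) K) ∈ homogeneousSubmodule (Fin n) K A.card := by
  have := IsHomogeneous.prod A (fun j => (X j : MvPolynomial (Fin n) K)) (fun _ => 1)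
    (fun j _ => isHomogeneous_X K j)
  simpa using this

variable {I : Ideal (MvPolynomial (Fin n) K)}

theorem IsSquarefreeMonomialIdeal.isGradedSub (hI : IsSquarefreeMonomialIdeal I) :
    IsGradedSub homogeneousComponent I := by
  obtain ⟨𝒢, rfl⟩ := hI
  refine isGradedSub_span_of_isHomogeneous ?_
  rintro _ ⟨A, -, rfl⟩
  exact ⟨_, prod_X_mem_homogeneousSubmodule A⟩

theorem isGradedModule_quotientGrading (hI : IsGradedSub homogeneousComponent I) :
    IsGradedModule (n := n) (quotientGrading I) where
  isInternal := by
    obtain ⟨p, hp⟩ := isProjFamily_homogeneousComponent.exists_map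
      (Ideal.Quotient.mkₐ K I).toLinearMap Ideal.Quotient.mk_surjective (fun j x hx => by
        have : x ∈ I := Ideal.Quotient.eq_zero_iff_mem.1 hx
        exact Ideal.Quotient.eq_zero_iff_mem.2 (hI j x this))
    exact hp.isInternal
  smul_mem := by
    rintro i j s _ hs ⟨x, hx, rfl⟩
    exact ⟨s * x, IsHomogeneous.mul hs hx, rfl⟩

theorem isGradedModule_idealGrading (hI : IsGradedSub homogeneousComponent I) :
    IsGradedModule (n := n) (idealGrading I) where
  isInternal := by
    obtain ⟨p, hp⟩ := isProjFamily_homogeneousComponent.exists_comap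
      (I.subtype.restrictScalars K) Subtype.val_injective
      (fun j x => ⟨⟨_, hI j x x.2⟩, rfl⟩)
    exact hp.isInternal
  smul_mem i j s x hs hx := IsHomogeneous.mul hs hx

theorem finrank_idealGrading (j : ℕ) :
    (Module.finrank K (idealGrading I j) : ℤ) =
      Module.finrank K (homogeneousSubmodule (Fin n) K j) -
        hilbertFun (homogeneousSubmodule (Fin n) K) I j := by
  have h : Module.finrank K (idealGrading I j) = Module.finrank K
      (homogeneousSubmodule (Fin n) K j ⊓ I.restrictScalars K :
        Submodule K (MvPolynomial (Fin n) K)) := by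
    have hinj : Function.Injective (I.subtype.restrictScalars K) := Subtype.val_injective
    have hrange : LinearMap.range (I.subtype.restrictScalars K) = I.restrictScalars K := by
      ext x
      simp
    rw [LinearEquiv.finrank_eq (Submodule.equivMapOfInjective _ hinj (idealGrading I j)),
      idealGrading, Submodule.map_comap_eq, inf_comm, hrange]
  rw [hilbertFun, h]
  ring

open scoped Classical in
theorem finrank_quotientGrading_le (j : ℕ) :
    Module.finrank K (quotientGrading I j) ≤
      ((Finset.univ.finsuppAntidiag j).filter
        fun a : Fin n →₀ ℕ => monomial a (1 : K) ∉ I).card := by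
  set T := (Finset.univ.finsuppAntidiag j).filter fun a : Fin n →₀ ℕ => monomial a (1 : K) ∉ I
  have hle : quotientGrading I j ≤ Submodule.span K
      ((T.image fun a => Ideal.Quotient.mk I (monomial a 1) :
        Finset (MvPolynomial (Fin n) K ⧸ I)) : Set (MvPolynomial (Fin n) K ⧸ I)) := by
    rintro _ ⟨f, hf, rfl⟩
    rw [← f.support_sum_monomial_coeff, map_sum]
    refine Submodule.sum_mem _ fun a ha => ?_
    have : monomial a (coeff a f) = coeff a f • monomial a (1 : K) := by
      rw [smul_monomial, smul_eq_mul, mul_one]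
    rw [this, map_smul]
    refine Submodule.smul_mem _ _ ?_
    by_cases hm : monomial a (1 : K) ∈ I
    · change Ideal.Quotient.mk I (monomial a 1) ∈ _
      rw [Ideal.Quotient.eq_zero_iff_mem.2 hm]
      exact zero_mem _
    · refine Submodule.subset_span ?_
      rw [Finset.mem_coe, Finset.mem_image]
      refine ⟨a, Finset.mem_filter.2 ⟨?_, hm⟩, rfl⟩
      rw [Finset.mem_finsuppAntidiag]
      refine ⟨?_, Finset.subset_univ _⟩
      have := hf (mem_support_iff.1 ha)
      rw [← this]
      exact (Finsupp.degree_eq_sum a).symm.trans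
        (DFunLike.congr_fun Finsupp.degree_eq_weight_one a)
  exact (Submodule.finrank_mono hle).trans
    ((finrank_span_finset_le_card _).trans Finset.card_image_le)

theorem prod_X_support_notMem {a : Fin n →₀ ℕ} (ha : monomial a (1 : K) ∉ I) :
    (∏ j ∈ a.support, X j : MvPolynomial (Fin n) K) ∉ I := by
  intro h
  apply ha
  have : (∏ j ∈ a.support, X j : MvPolynomial (Fin n) K) ∣ monomial a 1 := by
    rw [monomial_eq, C_1, one_mul, Finsupp.prod]
    exact Finset.prod_dvd_prod_of_dvd _ _ fun i hi =>
      dvd_pow_self _ (Finsupp.mem_support_iff.1 hi)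
  exact Ideal.mem_of_dvd I this h

/-- A monomial outside `I` is supported on a face. A face `F` carries at most `(j + 1) ^ |F|`
exponent vectors with entries up to `j`, and there are at most `2 ^ n` faces. -/
theorem sum_finrank_quotientGrading_le {d : ℕ}
    (hd : ∀ F : Finset (Fin n), (∏ j ∈ F, X j : MvPolynomial (Fin n) K) ∉ I → F.card ≤ d)
    (j : ℕ) :
    ∑ i ∈ Finset.range (j + 1), Module.finrank K (quotientGrading I i) ≤
      2 ^ n * (j + 1) ^ d := by
  classical
  let T : ℕ → Finset (Fin n →₀ ℕ) := fun j => (Finset.univ.finsuppAntidiag j).filter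
    fun a : Fin n →₀ ℕ => monomial a (1 : K) ∉ I
  let Δ : Finset (Finset (Fin n)) := Finset.univ.filter
    fun F => (∏ j ∈ F, X j : MvPolynomial (Fin n) K) ∉ I
  let B : Finset (Fin n) → Finset (Fin n → ℕ) := fun F =>
    Fintype.piFinset fun i => if i ∈ F then Finset.range (j + 1) else {0}
  calc ∑ i ∈ Finset.range (j + 1), Module.finrank K (quotientGrading I i)
      ≤ ∑ i ∈ Finset.range (j + 1), (T i).card :=
        Finset.sum_le_sum fun i _ => finrank_quotientGrading_le i
    _ = ((Finset.range (j + 1)).sigma T).card := (Finset.card_sigma _ _).symm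
    _ ≤ (Δ.biUnion B).card := by
        refine Finset.card_le_card_of_injOn (fun s => ⇑s.2) ?_ ?_
        · rintro ⟨i, a⟩ h
          simp only [Finset.mem_coe, Finset.mem_sigma, Finset.mem_range, T, Finset.mem_filter,
            Finset.mem_finsuppAntidiag] at h
          obtain ⟨hi, ⟨hs, -⟩, ha⟩ := h
          simp only [Finset.mem_coe, Finset.mem_biUnion]
          refine ⟨a.support, Finset.mem_filter.2 ⟨Finset.mem_univ _, prod_X_support_notMem ha⟩, ?_⟩
          rw [Fintype.mem_piFinset]
          intro k
          split_ifs with hk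
          · rw [Finset.mem_range]
            have : a k ≤ Finset.univ.sum a :=
              Finset.single_le_sum (fun _ _ => Nat.zero_le _) (Finset.mem_univ k)
            omega
          · simpa using hk
        · rintro ⟨i, a⟩ h ⟨i', a'⟩ h' heq
          simp only [Finset.mem_coe, Finset.mem_sigma, Finset.mem_range, T, Finset.mem_filter,
            Finset.mem_finsuppAntidiag] at h h'
          have : a = a' := DFunLike.coe_injective heq
          subst this
          have : i = i' := h.2.1.1.symm.trans h'.2.1.1
          rw [this]
    _ ≤ ∑ F ∈ Δ, (B F).card := Finset.card_biUnion_le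
    _ ≤ ∑ F ∈ Δ, (j + 1) ^ d := by
        refine Finset.sum_le_sum fun F hF => ?_
        have hB : (B F).card = (j + 1) ^ F.card := by
          rw [Fintype.card_piFinset]
          simp [apply_ite Finset.card]
        rw [hB]
        exact Nat.pow_le_pow_right (Nat.succ_pos _) (hd F (Finset.mem_filter.1 hF).2)
    _ = Δ.card * (j + 1) ^ d := by rw [Finset.sum_const, smul_eq_mul]
    _ ≤ 2 ^ n * (j + 1) ^ d := by
        refine Nat.mul_le_mul_right _ ?_
        refine (Finset.card_le_univ Δ).trans ?_
        simp

theorem sum_range_multichoose (r j : ℕ) :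
    ∑ i ∈ Finset.range (j + 1), Nat.multichoose r i = Nat.multichoose (r + 1) j := by
  induction j with
  | zero => simp
  | succ j ih => rw [Finset.sum_range_succ, ih, Nat.multichoose_succ_succ, add_comm]

theorem pow_le_factorial_mul_multichoose (r j : ℕ) :
    (j + 1) ^ r ≤ r.factorial * Nat.multichoose (r + 1) j := by
  have h := Nat.pow_sub_le_descFactorial (r + j) r
  rw [Nat.descFactorial_eq_factorial_mul_choose, show r + j + 1 - r = j + 1 by omega] at h
  rwa [Nat.multichoose_eq, show r + 1 + j - 1 = r + j by omega, ← Nat.choose_symm_add]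

/-- Comparison of growth orders. Summed values are used because they grow with exponent exactly `r`,
uniformly including `r = 0`. -/
theorem le_of_multichoose_le {r d C j₀ : ℕ} {h : ℕ → ℕ}
    (hlow : ∀ j, Nat.multichoose r j ≤ h (j₀ + j))
    (hup : ∀ j, ∑ i ∈ Finset.range (j + 1), h i ≤ C * (j + 1) ^ d) : r ≤ d := by
  by_contra! hr
  have key : ∀ j : ℕ, j + 1 ≤ r.factorial * C * (j₀ + 1) ^ d := by
    intro j
    have h1 : Nat.multichoose (r + 1) j ≤ C * (j₀ + j + 1) ^ d := by
      rw [← sum_range_multichoose]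
      refine le_trans ?_ (hup (j₀ + j))
      rw [add_assoc j₀, Finset.sum_range_add _ j₀]
      exact (Finset.sum_le_sum fun i _ => hlow i).trans (Nat.le_add_left _ _)
    have h2 : (j + 1) ^ (d + 1) ≤ r.factorial * C * (j₀ + 1) ^ d * (j + 1) ^ d :=
      calc (j + 1) ^ (d + 1) ≤ (j + 1) ^ r := Nat.pow_le_pow_right (Nat.succ_pos _) hr
        _ ≤ r.factorial * Nat.multichoose (r + 1) j := pow_le_factorial_mul_multichoose r j
        _ ≤ r.factorial * (C * (j₀ + j + 1) ^ d) := Nat.mul_le_mul_left _ h1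
        _ ≤ r.factorial * (C * ((j₀ + 1) * (j + 1)) ^ d) := by
          gcongr
          -- The shift is absorbed by `j₀ + j + 1 ≤ (j₀ + 1) * (j + 1)`.
          nlinarith [Nat.zero_le (j₀ * j)]
        _ = _ := by rw [mul_pow]; ring
    rw [pow_succ, mul_comm] at h2
    exact Nat.le_of_mul_le_mul_right h2 (by positivity)
  have := key (r.factorial * C * (j₀ + 1) ^ d)
  omega

end PolynomialRing

/-! ### Depth bounded by Hilbert function growth -/

section Depth

variable {K : Type u} [Field K] {n : ℕ} {N : Type*} [AddCommGroup N]
  [Module (MvPolynomial (Fin n) K) N]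

theorem depthGE_of_le_depth {W : Submodule (MvPolynomial (Fin n) K) N} {r : ℕ}
    (h : (r : ℕ∞) ≤ depth K n (N ⧸ W)) : DepthGE (maxIdeal K n) r W := by
  rcases r with _ | r
  · trivial
  · have hlt : (r : ℕ∞) < depth K n (N ⧸ W) :=
      lt_of_lt_of_le (by exact_mod_cast Nat.lt_succ_self r) h
    obtain ⟨l, ⟨rs, hrs, hreg, rfl⟩, hl⟩ := lt_sSup_iff.1 hlt
    have hl' : r + 1 ≤ rs.length := by exact_mod_cast hl
    exact ((regSeqMod_iff_isWeaklyRegular.2 hreg.toIsWeaklyRegular).depthGE hrs).mono hl'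

variable [Infinite K] [Module K N] [IsScalarTower K (MvPolynomial (Fin n) K) N]
  [Module.Finite (MvPolynomial (Fin n) K) N]

theorem depth_le_of_sum_finrank_le {𝒩 : ℕ → Submodule K N} (h𝒩 : IsGradedModule (n := n) 𝒩)
    {C d : ℕ} (hd : ∀ j, ∑ i ∈ Finset.range (j + 1), Module.finrank K (𝒩 i) ≤ C * (j + 1) ^ d) :
    depth K n N ≤ d := by
  classical
  refine sSup_le ?_
  rintro _ ⟨rs, hrs, hreg, rfl⟩
  have hreg' : RingTheory.Sequence.IsWeaklyRegular
      (N ⧸ (⊥ : Submodule (MvPolynomial (Fin n) K) N)) rs :=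
    (LinearEquiv.isWeaklyRegular_congr (Submodule.quotEquivOfEqBot _ rfl) rs).2
      hreg.toIsWeaklyRegular
  obtain ⟨v, hv⟩ := ((regSeqMod_iff_isWeaklyRegular.2 hreg').depthGE hrs).exists_linForm
  obtain ⟨p, hp⟩ := exists_isProjFamily h𝒩.isInternal
  have hfd := h𝒩.finiteDimensional
  have hfun : ∀ j, hilbertFun (n := n) 𝒩 ⊥ j = Module.finrank K (𝒩 j) := by
    intro j
    have : 𝒩 j ⊓ (⊥ : Submodule (MvPolynomial (Fin n) K) N).restrictScalars K = ⊥ := by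
      rw [Submodule.restrictScalars_bot, inf_bot_eq]
    rw [hilbertFun, this, finrank_bot, Nat.cast_zero, sub_zero]
  -- A regular sequence, unlike a weakly regular one, forces `N ≠ 0`; the least such `j` serves as
  -- the initial degree.
  have hne : ∃ j, Module.finrank K (𝒩 j) ≠ 0 := by
    by_contra! hz
    have := hreg.nontrivial
    obtain ⟨x, hx⟩ := exists_ne (0 : N)
    obtain ⟨s, hs⟩ := hp.sum x
    apply hx
    rw [← hs]
    refine Finset.sum_eq_zero fun i _ => ?_
    have := hp.mem i x
    rwa [Submodule.finrank_eq_zero.1 (hz i), Submodule.mem_bot] at this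
  have hlow := multichoose_le_hilbertFun hp h𝒩 (W := ⊥) (j₀ := Nat.find hne) (by
      intro r hr
      obtain ⟨i, rfl⟩ := (List.mem_ofFn' _ _).1 hr
      exact linForm_mem_homogeneousSubmodule _)
    (fun j x hx => by rw [(Submodule.mem_bot _).1 hx, map_zero]; exact zero_mem _) hv
    (fun j hj => by
      rw [hfun]
      exact_mod_cast not_not.1 (Nat.find_min hne hj))
    (by
      rw [hfun]
      exact_mod_cast Nat.one_le_iff_ne_zero.2 (Nat.find_spec hne))
  simp only [hfun, List.length_ofFn, Nat.cast_le] at hlow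
  exact_mod_cast le_of_multichoose_le hlow hd

end Depth

section SquarefreeAndCoordinates

variable {K : Type u} [Field K] {n : ℕ}

/-! ### Faces, Krull dimension and Stanley depth -/

section SquarefreeMonomialIdeals

variable {I : Ideal (MvPolynomial (Fin n) K)}

theorem one_notMem_maxIdeal : (1 : MvPolynomial (Fin n) K) ∉ maxIdeal K n := by
  have hle : maxIdeal K n ≤ RingHom.ker (constantCoeff (R := K) (σ := Fin n)) := by
    refine Ideal.span_le.2 ?_
    rintro _ ⟨i, rfl⟩
    simp
  intro h
  simpa using hle h

theorem IsSquarefreeMonomialIdeal.le_maxIdeal (hI : IsSquarefreeMonomialIdeal I)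
    (hproper : I ≠ ⊤) : I ≤ maxIdeal K n := by
  obtain ⟨𝒢, rfl⟩ := hI
  refine Ideal.span_le.2 ?_
  rintro _ ⟨A, hA, rfl⟩
  rcases A.eq_empty_or_nonempty with rfl | ⟨i, hi⟩
  · refine absurd ?_ hproper
    rw [Ideal.eq_top_iff_one]
    exact Ideal.subset_span ⟨∅, hA, by simp⟩
  · exact Ideal.mem_of_dvd _ (Finset.dvd_prod_of_mem _ hi) (X_mem_maxIdeal i)

theorem IsSquarefreeMonomialIdeal.prod_univ_mem (hI : IsSquarefreeMonomialIdeal I)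
    (hne : I ≠ ⊥) : (∏ j, X j : MvPolynomial (Fin n) K) ∈ I := by
  obtain ⟨𝒢, rfl⟩ := hI
  by_cases h : ∃ A, A ∈ 𝒢
  · obtain ⟨A, hA⟩ := h
    exact Ideal.mem_of_dvd _ (Finset.prod_dvd_prod_of_subset _ _ _ (Finset.subset_univ A))
      (Ideal.subset_span ⟨A, hA, rfl⟩)
  · refine absurd ?_ hne
    rw [Set.eq_empty_iff_forall_notMem.2 (not_exists.1 h), Set.image_empty, Ideal.span_empty]

/-- Killing the variables outside a face `F` kills every generator `x_A`, since `A ⊄ F`; thus `S/I`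
surjects onto `K[F]`. -/
theorem IsSquarefreeMonomialIdeal.card_le_ringKrullDim (hI : IsSquarefreeMonomialIdeal I)
    {F : Finset (Fin n)} (hF : (∏ j ∈ F, X j : MvPolynomial (Fin n) K) ∉ I) :
    ((F.card : ℕ∞) : WithBot ℕ∞) ≤ ringKrullDim (MvPolynomial (Fin n) K ⧸ I) := by
  classical
  let f : MvPolynomial (Fin n) K →ₐ[K] MvPolynomial F K :=
    aeval fun i => if h : i ∈ F then X ⟨i, h⟩ else 0
  have hf : Function.Surjective f := by
    rw [← AlgHom.range_eq_top, ← top_le_iff, ← adjoin_range_X, Algebra.adjoin_le_iff]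
    rintro _ ⟨i, rfl⟩
    exact ⟨X i.1, by simp [f]⟩
  have hIf : ∀ x ∈ I, f x = 0 := by
    obtain ⟨𝒢, rfl⟩ := hI
    have hle : Ideal.span ((fun A => ∏ j ∈ A, X j) '' 𝒢) ≤ RingHom.ker f := by
      refine Ideal.span_le.2 ?_
      rintro _ ⟨A, hA, rfl⟩
      have hAF : ¬ A ⊆ F := fun hAF => hF <|
        Ideal.mem_of_dvd _ (Finset.prod_dvd_prod_of_subset _ _ _ hAF)
          (Ideal.subset_span ⟨A, hA, rfl⟩)
      obtain ⟨i, hiA, hiF⟩ := Finset.not_subset.1 hAF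
      change f (∏ j ∈ A, X j) = 0
      rw [map_prod]
      exact Finset.prod_eq_zero hiA (by simp [f, hiF])
    exact fun x hx => hle hx
  have := ringKrullDim_le_of_surjective (Ideal.Quotient.lift I f.toRingHom hIf)
    (Ideal.Quotient.lift_surjective_of_surjective _ _ hf)
  rw [MvPolynomial.ringKrullDim_of_isNoetherianRing, ringKrullDim_eq_zero_of_field, zero_add,
    Nat.card_eq_fintype_card, Fintype.card_coe] at this
  exact this

/-- Each `Z i` is a face: otherwise the product of its variables is a nonzero element of `K[Z i]`
sent to zero, against freeness. -/
theorem sdepthQuotient_le {d : ℕ} (hproper : I ≠ ⊤)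
    (hd : ∀ F : Finset (Fin n), (∏ j ∈ F, X j : MvPolynomial (Fin n) K) ∉ I → F.card ≤ d) :
    sdepthQuotient I ≤ d := by
  refine iSup_le fun D => ?_
  -- An infimum over no summands would be `⊤`, so at least one summand is needed.
  have hr : 0 < D.r := by
    by_contra! h
    have hempty : IsEmpty (Fin D.r) := by
      rw [Nat.le_zero.1 h]
      infer_instance
    have htop := D.isInternal.submodule_iSup_eq_top
    rw [iSup_of_empty] at htop
    have : Nontrivial (MvPolynomial (Fin n) K ⧸ I) := Ideal.Quotient.nontrivial_iff.2 hproper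
    exact bot_ne_top htop
  refine iInf_le_of_le ⟨0, hr⟩ ?_
  rw [Nat.cast_le]
  refine hd _ fun hmem => ?_
  have hz : stanleyMap I (D.a ⟨0, hr⟩) (D.Z ⟨0, hr⟩) (∏ j, X j) = 0 := by
    change Ideal.Quotient.mk I (monomial _ 1 * rename Subtype.val (∏ j, X j)) = 0
    refine Ideal.Quotient.eq_zero_iff_mem.2 (Ideal.mul_mem_left _ _ ?_)
    rw [map_prod]
    simp only [rename_X]
    rwa [Finset.prod_coe_sort (D.Z ⟨0, hr⟩) fun j => (X j : MvPolynomial (Fin n) K)]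
  have := D.free ⟨0, hr⟩ (hz.trans (map_zero _).symm)
  exact Finset.prod_ne_zero_iff.2 (fun j _ => X_ne_zero j) this

end SquarefreeMonomialIdeals

/-! ### Linear changes of coordinates -/

section LinearCoordinates

/-- Modulo the first form the remaining coefficients vanish by induction. If the first did not, that
form would lie in `W`, and its regularity would put `1` in `W ≤ 𝔪`. -/
theorem linForm_independent {d : ℕ} {W : Ideal (MvPolynomial (Fin n) K)}
    (hW : W ≤ maxIdeal K n) {v : Fin d → Fin n → K}
    (h : RegSeqMod (List.ofFn fun i => linForm K n (v i)) W) {c : Fin d → K}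
    (hc : linForm K n (∑ i, c i • v i) ∈ W) : c = 0 := by
  induction d generalizing W with
  | zero => exact Subsingleton.elim _ _
  | succ d ih =>
    rw [List.ofFn_succ] at h
    have hle : adjoinSMul (linForm K n (v 0)) W ≤ maxIdeal K n := by
      intro x hx
      obtain ⟨w, hw, y, rfl⟩ := mem_adjoinSMul.1 hx
      exact add_mem (hW hw) (Ideal.mul_mem_right _ _ (linForm_mem_maxIdeal _))
    rw [Fin.sum_univ_succ, map_add, map_smul] at hc
    have hsucc : (fun i : Fin d => c i.succ) = 0 := ih hle h.2 (by
      refine mem_adjoinSMul.2 ⟨_, hc, -C (c 0), ?_⟩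
      rw [smul_eq_mul, smul_eq_C_mul]
      ring)
    have hsucc' : ∀ i : Fin d, c i.succ = 0 := fun i => congrFun hsucc i
    have h0 : c 0 = 0 := by
      by_contra hne
      simp only [hsucc', zero_smul, Finset.sum_const_zero, map_zero, add_zero] at hc
      have hmem : linForm K n (v 0) ∈ W := by
        have := (W.restrictScalars K).smul_mem (c 0)⁻¹ hc
        rwa [smul_smul, inv_mul_cancel₀ hne, one_smul] at this
      have := h.1 1 (by rwa [smul_eq_mul, mul_one])
      exact one_notMem_maxIdeal (hW this)
    ext i
    refine Fin.cases h0 hsucc' i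

theorem exists_linearEquiv_single {d : ℕ} {v : Fin d → Fin n → K} (hv : LinearIndependent K v) :
    ∃ (A : (Fin n → K) ≃ₗ[K] (Fin n → K)) (t : Fin d → Fin n), Function.Injective t ∧
      ∀ i, A (Pi.single (t i) 1) = v i := by
  let b := Module.Basis.extend hv.linearIndepOn_id
  let σ := b.indexEquiv (Pi.basisFun K (Fin n))
  let e : Fin d → hv.linearIndepOn_id.extend (Set.subset_univ (Set.range v)) := fun i =>
    ⟨v i, hv.linearIndepOn_id.subset_extend _ ⟨i, rfl⟩⟩
  refine ⟨(Pi.basisFun K (Fin n)).equiv b σ.symm, fun i => σ (e i), ?_, fun i => ?_⟩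
  · intro i j hij
    exact hv.injective (congrArg Subtype.val (σ.injective hij))
  · rw [← Pi.basisFun_apply, Module.Basis.equiv_apply, Equiv.symm_apply_apply]
    exact Module.Basis.extend_apply_self _ _

/-- The endomorphism of the polynomial ring induced by an endomorphism of the space of
linear forms. -/
def substLinear (A : (Fin n → K) →ₗ[K] (Fin n → K)) :
    MvPolynomial (Fin n) K →ₐ[K] MvPolynomial (Fin n) K :=
  aeval fun i => linForm K n (A (Pi.single i 1))

theorem substLinear_X (A : (Fin n → K) →ₗ[K] (Fin n → K)) (i : Fin n) :
    substLinear A (X i) = linForm K n (A (Pi.single i 1)) := aeval_X _ _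

theorem substLinear_linForm (A : (Fin n → K) →ₗ[K] (Fin n → K)) (v : Fin n → K) :
    substLinear A (linForm K n v) = linForm K n (A v) := by
  have : (substLinear A).toLinearMap ∘ₗ linForm K n = linForm K n ∘ₗ A := by
    refine (Pi.basisFun K (Fin n)).ext fun i => ?_
    rw [Pi.basisFun_apply]
    change substLinear A (linForm K n _) = linForm K n (A _)
    rw [linForm_single, substLinear_X]
  exact LinearMap.congr_fun this v

theorem substLinear_comp (A B : (Fin n → K) →ₗ[K] (Fin n → K)) :
    (substLinear A).comp (substLinear B) = substLinear (A ∘ₗ B) := by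
  refine algHom_ext fun i => ?_
  rw [AlgHom.comp_apply, substLinear_X, substLinear_X, substLinear_linForm]
  rfl

theorem substLinear_id : substLinear (LinearMap.id : (Fin n → K) →ₗ[K] (Fin n → K)) =
    AlgHom.id K _ := by
  refine algHom_ext fun i => ?_
  rw [substLinear_X, LinearMap.id_apply, linForm_single]
  rfl

/-- The linear change of coordinates given by a linear automorphism. -/
def substLinearEquiv (A : (Fin n → K) ≃ₗ[K] (Fin n → K)) :
    MvPolynomial (Fin n) K ≃ₐ[K] MvPolynomial (Fin n) K :=
  AlgEquiv.ofAlgHom (substLinear A.toLinearMap) (substLinear A.symm.toLinearMap)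
    (by rw [substLinear_comp, LinearEquiv.comp_symm, substLinear_id])
    (by rw [substLinear_comp, LinearEquiv.symm_comp, substLinear_id])

theorem substLinearEquiv_apply (A : (Fin n → K) ≃ₗ[K] (Fin n → K))
    (f : MvPolynomial (Fin n) K) :
    substLinearEquiv A f = aeval (fun i => linForm K n (A (Pi.single i 1))) f := rfl

theorem aeval_mem_homogeneousSubmodule {u : Fin n → MvPolynomial (Fin n) K}
    (hu : ∀ i, u i ∈ homogeneousSubmodule (Fin n) K 1) {j : ℕ} {f : MvPolynomial (Fin n) K}
    (hf : f ∈ homogeneousSubmodule (Fin n) K j) :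
    aeval u f ∈ homogeneousSubmodule (Fin n) K j := by
  have := IsHomogeneous.aeval hf u hu
  rwa [one_mul] at this

theorem homogeneousComponent_aeval {u : Fin n → MvPolynomial (Fin n) K}
    (hu : ∀ i, u i ∈ homogeneousSubmodule (Fin n) K 1) (j : ℕ) (f : MvPolynomial (Fin n) K) :
    homogeneousComponent j (aeval u f) = aeval u (homogeneousComponent j f) := by
  have : homogeneousComponent j ∘ₗ (aeval u).toLinearMap =
      (aeval u).toLinearMap ∘ₗ homogeneousComponent j := by
    refine isProjFamily_homogeneousComponent.ext fun i x hx => ?_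
    change homogeneousComponent j (aeval u x) = aeval u (homogeneousComponent j x)
    have hux := aeval_mem_homogeneousSubmodule hu hx
    rcases eq_or_ne i j with rfl | hij
    · rw [isProjFamily_homogeneousComponent.of_mem _ _ hux,
        isProjFamily_homogeneousComponent.of_mem _ _ hx]
    · rw [isProjFamily_homogeneousComponent.of_mem_ne _ _ hij _ hux,
        isProjFamily_homogeneousComponent.of_mem_ne _ _ hij _ hx, map_zero]
  exact LinearMap.congr_fun this f

theorem substLinearEquiv_mem_homogeneousSubmodule (A : (Fin n → K) ≃ₗ[K] (Fin n → K)) {j : ℕ}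
    {f : MvPolynomial (Fin n) K} (hf : f ∈ homogeneousSubmodule (Fin n) K j) :
    substLinearEquiv A f ∈ homogeneousSubmodule (Fin n) K j := by
  rw [substLinearEquiv_apply]
  exact aeval_mem_homogeneousSubmodule (fun i => linForm_mem_homogeneousSubmodule _) hf

theorem IsGradedSub.comap_substLinearEquiv {I : Ideal (MvPolynomial (Fin n) K)}
    (hI : IsGradedSub homogeneousComponent I) (A : (Fin n → K) ≃ₗ[K] (Fin n → K)) :
    IsGradedSub homogeneousComponent (I.comap (substLinearEquiv A)) := by
  intro j x hx
  have := hI j _ (Ideal.mem_comap.1 hx)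
  rwa [Ideal.mem_comap, substLinearEquiv_apply,
    ← homogeneousComponent_aeval fun i => linForm_mem_homogeneousSubmodule _,
    ← substLinearEquiv_apply]

theorem hilbertFun_comap (I : Ideal (MvPolynomial (Fin n) K))
    (e : MvPolynomial (Fin n) K ≃ₐ[K] MvPolynomial (Fin n) K) (j : ℕ)
    (he : ∀ f ∈ homogeneousSubmodule (Fin n) K j, e f ∈ homogeneousSubmodule (Fin n) K j)
    (he' : ∀ f ∈ homogeneousSubmodule (Fin n) K j, e.symm f ∈ homogeneousSubmodule (Fin n) K j) :
    hilbertFun (homogeneousSubmodule (Fin n) K) (I.comap e) j =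
      hilbertFun (homogeneousSubmodule (Fin n) K) I j := by
  have h : (homogeneousSubmodule (Fin n) K j ⊓ (I.comap e).restrictScalars K).map
        e.toLinearEquiv.toLinearMap =
      homogeneousSubmodule (Fin n) K j ⊓ I.restrictScalars K := by
    apply le_antisymm
    · rintro _ ⟨x, ⟨hx, hx'⟩, rfl⟩
      exact ⟨he x hx, hx'⟩
    · rintro x ⟨hx, hx'⟩
      refine ⟨e.symm x, ⟨he' x hx, ?_⟩, e.apply_symm_apply x⟩
      change e (e.symm x) ∈ I
      rwa [AlgEquiv.apply_symm_apply]
  rw [hilbertFun, hilbertFun, ← h]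
  congr 2
  exact (LinearEquiv.finrank_map_eq _ _).symm

theorem hilbertFun_comap_substLinearEquiv (I : Ideal (MvPolynomial (Fin n) K))
    (A : (Fin n → K) ≃ₗ[K] (Fin n → K)) (j : ℕ) :
    hilbertFun (homogeneousSubmodule (Fin n) K) (I.comap (substLinearEquiv A)) j =
      hilbertFun (homogeneousSubmodule (Fin n) K) I j :=
  hilbertFun_comap I _ j (fun _ hf => substLinearEquiv_mem_homogeneousSubmodule A hf)
    (fun _ hf => substLinearEquiv_mem_homogeneousSubmodule A.symm hf)

theorem RegSeqMod.comap {R : Type*} [CommRing R] [Algebra K R] (e : R ≃ₐ[K] R) {I : Ideal R} {rs : List R}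
    (h : RegSeqMod (rs.map e) I) : RegSeqMod rs (I.comap e) := by
  induction rs generalizing I with
  | nil => trivial
  | cons x xs ih =>
    refine ⟨fun m hm => h.1 (e m) ?_, ?_⟩
    · have := Ideal.mem_comap.1 hm
      rwa [smul_eq_mul, map_mul] at this
    · have heq : adjoinSMul x (I.comap e) = Ideal.comap e (adjoinSMul (e x) I) := by
        ext m
        rw [Ideal.mem_comap, mem_adjoinSMul, mem_adjoinSMul]
        constructor
        · rintro ⟨w, hw, y, rfl⟩
          exact ⟨e w, hw, e y, by simp⟩
        · rintro ⟨w, hw, y, hy⟩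
          refine ⟨e.symm w, Ideal.mem_comap.2 (by rwa [e.apply_symm_apply]), e.symm y, e.injective ?_⟩
          simpa using hy
      rw [heq]
      exact ih h.2

end LinearCoordinates

/-! ### Ideals generated without given variables -/

section DivisionByVariable

/-- Division by `x_i` (discarding the remainder) commutes with multiplication by `g`. -/
def CommutesDiv (i : Fin n) (g : MvPolynomial (Fin n) K) : Prop :=
  ∀ s : MvPolynomial (Fin n) K,
    (s * g).divMonomial (Finsupp.single i 1) = s.divMonomial (Finsupp.single i 1) * g

theorem commutesDiv_X {i j : Fin n} (hij : j ≠ i) :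
    CommutesDiv i (X j : MvPolynomial (Fin n) K) := by
  intro s
  ext b
  rw [coeff_divMonomial, coeff_mul_X', coeff_mul_X', coeff_divMonomial]
  have hmem : j ∈ (Finsupp.single i 1 + b).support ↔ j ∈ b.support := by
    simp [hij.symm]
  simp only [hmem]
  split_ifs with hj
  · congr 1
    ext k
    have : 1 ≤ b j := Nat.one_le_iff_ne_zero.2 (Finsupp.mem_support_iff.1 hj)
    simp only [Finsupp.tsub_apply, Finsupp.add_apply, Finsupp.single_apply]
    split_ifs <;> grind
  · rfl

theorem commutesDiv_aeval {i : Fin n} {u : Fin n → MvPolynomial (Fin n) K}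
    (hu : ∀ j, CommutesDiv i (u j)) (f : MvPolynomial (Fin n) K) : CommutesDiv i (aeval u f) := by
  induction f using MvPolynomial.induction_on with
  | C a =>
    intro s
    ext b
    rw [aeval_C, algebraMap_eq, mul_comm s, mul_comm _ (C a), coeff_divMonomial, coeff_C_mul,
      coeff_C_mul, coeff_divMonomial]
  | add p q hp hq =>
    intro s
    rw [map_add, mul_add, add_divMonomial, hp, hq, mul_add]
  | mul_X p j hp =>
    intro s
    rw [map_mul, aeval_X, ← mul_assoc, hu, hp, mul_assoc]

theorem commutesDiv_zero (i : Fin n) : CommutesDiv i (0 : MvPolynomial (Fin n) K) := by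
  intro s
  simp

/-- If no generator involves `x_i`, dividing `∑ s g` by `x_i` only affects the coefficients `s`. -/
theorem divMonomial_mem_span {i : Fin n} {G : Set (MvPolynomial (Fin n) K)}
    (hG : ∀ g ∈ G, CommutesDiv i g) {f : MvPolynomial (Fin n) K} (hf : f ∈ Ideal.span G) :
    f.divMonomial (Finsupp.single i 1) ∈ Ideal.span G := by
  -- The extra factor `s` lets the span induction pass through scalar multiplication, with which
  -- division does not commute.
  suffices h : ∀ s : MvPolynomial (Fin n) K,
      (s * f).divMonomial (Finsupp.single i 1) ∈ Ideal.span G by simpa using h 1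
  induction hf using Submodule.span_induction with
  | mem g hg =>
    intro s
    rw [hG g hg]
    exact Ideal.mul_mem_left _ _ (Ideal.subset_span hg)
  | zero => simp
  | add x y _ _ hx hy =>
    intro s
    rw [mul_add, add_divMonomial]
    exact add_mem (hx s) (hy s)
  | smul t x _ hx =>
    intro s
    rw [smul_eq_mul, ← mul_assoc]
    exact hx (s * t)

theorem regMod_X_span {i : Fin n} {G : Set (MvPolynomial (Fin n) K)}
    (hG : ∀ g ∈ G, CommutesDiv i g) :
    RegMod (X i : MvPolynomial (Fin n) K) (Ideal.span G) := by
  intro f hf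
  have := divMonomial_mem_span hG hf
  rwa [smul_eq_mul, X_mul_divMonomial] at this

theorem regSeqMod_map_X {ts : List (Fin n)} (hts : ts.Nodup) {G : Set (MvPolynomial (Fin n) K)}
    (hG : ∀ i ∈ ts, ∀ g ∈ G, CommutesDiv i g) :
    RegSeqMod (ts.map X) (Ideal.span G : Ideal (MvPolynomial (Fin n) K)) := by
  induction ts generalizing G with
  | nil => trivial
  | cons i ts ih =>
    rw [List.nodup_cons] at hts
    refine ⟨regMod_X_span (hG i (by simp)), ?_⟩
    have heq : adjoinSMul (X i) (Ideal.span G : Ideal (MvPolynomial (Fin n) K)) =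
        Ideal.span (insert (X i) G) := by
      ext f
      rw [mem_adjoinSMul, Ideal.span_insert, Submodule.mem_sup]
      constructor
      · rintro ⟨w, hw, y, rfl⟩
        exact ⟨X i * y, Ideal.mem_span_singleton'.2 ⟨y, mul_comm _ _⟩, w, hw, add_comm _ _⟩
      · rintro ⟨z, hz, w, hw, rfl⟩
        obtain ⟨y, rfl⟩ := Ideal.mem_span_singleton'.1 hz
        exact ⟨w, hw, y, by rw [smul_eq_mul]; ring⟩
    rw [heq]
    refine ih hts.2 fun j hj g hg => ?_
    rcases hg with rfl | hg
    · exact commutesDiv_X fun hij => hts.1 (hij ▸ hj)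
    · exact hG j (by simp [hj]) g hg

theorem foldl_adjoinSMul (rs : List (MvPolynomial (Fin n) K))
    (W : Ideal (MvPolynomial (Fin n) K)) :
    rs.foldl (fun V x => adjoinSMul x V) W = W ⊔ Ideal.ofList rs := by
  induction rs generalizing W with
  | nil => simp
  | cons x xs ih =>
    rw [List.foldl_cons, ih, Ideal.ofList_cons, ← sup_assoc]
    congr 1
    ext f
    rw [mem_adjoinSMul, Submodule.mem_sup]
    constructor
    · rintro ⟨w, hw, y, rfl⟩
      exact ⟨w, hw, _, Ideal.mem_span_singleton'.2 ⟨y, mul_comm _ _⟩, rfl⟩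
    · rintro ⟨w, hw, z, hz, rfl⟩
      obtain ⟨y, rfl⟩ := Ideal.mem_span_singleton'.1 hz
      exact ⟨w, hw, y, by rw [smul_eq_mul, mul_comm]⟩

/-- The projection of the polynomial ring sending the variables in `ts` to zero. -/
def killVars (ts : List (Fin n)) : MvPolynomial (Fin n) K →ₐ[K] MvPolynomial (Fin n) K :=
  aeval fun i => if i ∈ ts then 0 else X i

theorem sub_killVars_mem (ts : List (Fin n)) (f : MvPolynomial (Fin n) K) :
    f - killVars ts f ∈ Ideal.ofList (ts.map X : List (MvPolynomial (Fin n) K)) := by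
  set J := Ideal.ofList (ts.map X : List (MvPolynomial (Fin n) K))
  have h : (Ideal.Quotient.mkₐ K J).comp (killVars ts) = Ideal.Quotient.mkₐ K J := by
    refine algHom_ext fun i => ?_
    rw [AlgHom.comp_apply, killVars, aeval_X]
    split_ifs with hi
    · rw [map_zero]
      refine (Ideal.Quotient.eq_zero_iff_mem.2 ?_).symm
      exact Ideal.subset_span (List.mem_map.2 ⟨i, hi, rfl⟩)
    · rfl
  rw [← Ideal.Quotient.eq_zero_iff_mem, map_sub, sub_eq_zero]
  exact (AlgHom.congr_fun h f).symm

theorem commutesDiv_killVars {ts : List (Fin n)} {i : Fin n} (hi : i ∈ ts)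
    (f : MvPolynomial (Fin n) K) : CommutesDiv i (killVars ts f) := by
  refine commutesDiv_aeval (fun j => ?_) f
  split_ifs with hj
  · exact commutesDiv_zero i
  · exact commutesDiv_X fun hij => hj (hij ▸ hi)

variable {I : Ideal (MvPolynomial (Fin n) K)} {ts : List (Fin n)}

theorem isGradedSub_span_killVars (hI : IsGradedSub homogeneousComponent I) :
    IsGradedSub homogeneousComponent (Ideal.span (killVars ts '' (I : Set (MvPolynomial (Fin n) K)))) := by
  refine isGradedSub_span ?_
  rintro _ ⟨f, hf, rfl⟩ j
  refine Ideal.subset_span ⟨homogeneousComponent j f, hI j f hf, ?_⟩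
  refine (homogeneousComponent_aeval (fun i => ?_) j f).symm
  split_ifs
  · exact zero_mem _
  · exact isHomogeneous_X K i

/-- Degenerating along a regular sequence of variables preserves the Hilbert function. -/
theorem hilbertFun_span_killVars (hI : IsGradedSub homogeneousComponent I) (hts : ts.Nodup)
    (hreg : RegSeqMod (ts.map X) I) (j : ℕ) :
    hilbertFun (homogeneousSubmodule (Fin n) K) (Ideal.span (killVars ts '' (I : Set (MvPolynomial (Fin n) K)))) j =
      hilbertFun (homogeneousSubmodule (Fin n) K) I j := by
  refine hilbertFun_eq_of_regSeqMod isProjFamily_homogeneousComponent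
    isGradedModule_homogeneousSubmodule (rs := ts.map X) ?_ (isGradedSub_span_killVars hI) hI
    (regSeqMod_map_X hts ?_) hreg ?_ j
  · intro r hr
    obtain ⟨i, -, rfl⟩ := List.mem_map.1 hr
    exact isHomogeneous_X K i
  · rintro i hi _ ⟨f, -, rfl⟩
    exact commutesDiv_killVars hi f
  -- The final quotients agree because `f` and `killVars ts f` differ by an element of `(ts)`.
  · rw [foldl_adjoinSMul, foldl_adjoinSMul]
    apply le_antisymm
    · refine sup_le (Ideal.span_le.2 ?_) le_sup_right
      rintro _ ⟨f, hf, rfl⟩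
      rw [SetLike.mem_coe, ← sub_sub_cancel f (killVars ts f)]
      exact sub_mem (Ideal.mem_sup_left hf) (Ideal.mem_sup_right (sub_killVars_mem ts f))
    · refine sup_le (fun f hf => ?_) le_sup_right
      rw [← add_sub_cancel (killVars ts f) f]
      exact add_mem (Ideal.mem_sup_left (Ideal.subset_span ⟨f, hf, rfl⟩))
        (Ideal.mem_sup_right (sub_killVars_mem ts f))

/-- For `J = span G`, the submodules `J ∩ (x_s)` track the successive quotients, through `J ∩ (x_s,
x_i) = J ∩ (x_s) + x_i J`. Each quotient `J/(J ∩ (x_s))` embeds in `S/(x_s)`, where any variable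
outside `s` is a nonzerodivisor. Hence `z` may be appended even if the generators of `J` involve it:
this is the source of the extra unit of depth. -/
theorem regSeqMod_ideal {G : Set (MvPolynomial (Fin n) K)} (hts : ts.Nodup)
    (hG : ∀ i ∈ ts, ∀ g ∈ G, CommutesDiv i g) {z : Fin n} (hz : z ∉ ts) {s : Set (Fin n)}
    (hs : ∀ i ∈ ts, i ∉ s) (hzs : z ∉ s) :
    RegSeqMod ((ts ++ [z]).map X)
      (Submodule.comap (Ideal.span G).subtype (Ideal.span (X '' s))) := by
  have hdiv : ∀ {i : Fin n} {s : Set (Fin n)}, i ∉ s →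
      ∀ g ∈ (X '' s : Set (MvPolynomial (Fin n) K)), CommutesDiv i g := by
    rintro i s hi _ ⟨j, hj, rfl⟩
    exact commutesDiv_X fun hji => hi (hji ▸ hj)
  have hreg : ∀ {i : Fin n} {s : Set (Fin n)}, i ∉ s →
      RegMod (X i : MvPolynomial (Fin n) K)
        (Submodule.comap (Ideal.span G).subtype (Ideal.span (X '' s))) :=
    fun hi m hm => regMod_X_span (hdiv hi) m.1 hm
  induction ts generalizing s with
  | nil => exact ⟨hreg hzs, trivial⟩
  | cons i ts ih =>
    rw [List.nodup_cons] at hts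
    have his : i ∉ s := hs i (by simp)
    refine ⟨hreg his, ?_⟩
    have heq : adjoinSMul (X i : MvPolynomial (Fin n) K)
        (Submodule.comap (Ideal.span G).subtype (Ideal.span (X '' s))) =
        Submodule.comap (Ideal.span G).subtype (Ideal.span (X '' insert i s)) := by
      ext m
      rw [mem_adjoinSMul, Submodule.mem_comap, Set.image_insert_eq, Ideal.span_insert,
        Submodule.mem_sup]
      constructor
      · rintro ⟨w, hw, y, rfl⟩
        exact ⟨X i * y.1, Ideal.mem_span_singleton'.2 ⟨y, mul_comm _ _⟩, w.1, hw, add_comm _ _⟩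
      · rintro ⟨b, hb, a, ha, hba⟩
        obtain ⟨b, rfl⟩ := Ideal.mem_span_singleton'.1 hb
        -- For `m = b x_i + a` with `a` in `(x_s)`, the quotient of `m` by `x_i` stays in `J`, and
        -- subtracting `x_i y` leaves only the remainder of `a`, which is in `(x_s)`.
        let y : Ideal.span G := ⟨m.1.divMonomial (Finsupp.single i 1),
          divMonomial_mem_span (hG i (by simp)) m.2⟩
        refine ⟨m - (X i : MvPolynomial (Fin n) K) • y, ?_, y, sub_add_cancel _ _⟩
        have hval : (m - (X i : MvPolynomial (Fin n) K) • y).1 =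
            a - X i * a.divMonomial (Finsupp.single i 1) := by
          change m.1 - X i * m.1.divMonomial (Finsupp.single i 1) = _
          have hm : m.1 = b * X i + a := hba.symm
          rw [hm, add_divMonomial, mul_X_divMonomial]
          ring
        rw [Submodule.mem_comap, Submodule.subtype_apply, hval]
        exact sub_mem ha (Ideal.mul_mem_left _ _ (divMonomial_mem_span (hdiv his) ha))
    rw [heq]
    refine ih hts.2 (fun j hj => hG j (by simp [hj])) (fun h => hz (by simp [h])) ?_ ?_
    · intro j hj
      rw [Set.mem_insert_iff, not_or]
      exact ⟨fun hji => hts.1 (hji ▸ hj), hs j (by simp [hj])⟩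
    · rw [Set.mem_insert_iff, not_or]
      exact ⟨fun h => hz (by simp [h]), hzs⟩

theorem depth_span_ge {G : Set (MvPolynomial (Fin n) K)} (hts : ts.Nodup)
    (hG : ∀ i ∈ ts, ∀ g ∈ G, CommutesDiv i g) {z : Fin n} (hz : z ∉ ts)
    (hne : Ideal.span G ≠ ⊥) :
    ((ts.length + 1 : ℕ) : ℕ∞) ≤ depth K n (Ideal.span G) := by
  refine le_sSup ⟨(ts ++ [z]).map X, ?_, ⟨?_, ?_⟩, by simp⟩
  · intro r hr
    obtain ⟨i, -, rfl⟩ := List.mem_map.1 hr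
    exact X_mem_maxIdeal i
  · have h := regSeqMod_ideal hts hG hz (s := ∅) (by simp) (by simp)
    rw [Set.image_empty, Ideal.span_empty, regSeqMod_iff_isWeaklyRegular] at h
    have hbot : Submodule.comap (Ideal.span G).subtype (⊥ : Ideal (MvPolynomial (Fin n) K)) = ⊥ := by
      ext x
      simp
    exact (LinearEquiv.isWeaklyRegular_congr (Submodule.quotEquivOfEqBot _ hbot) _).1 h
  -- Nakayama: otherwise some `r ≡ 1` modulo the sequence annihilates the ideal; over a domain `r =
  -- 0`, so `1` would be in `𝔪`.
  · intro htop
    obtain ⟨r, hr, hr0⟩ := Submodule.exists_sub_one_mem_and_smul_eq_zero_of_fg_of_le_smul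
      (Ideal.ofList ((ts ++ [z]).map X : List (MvPolynomial (Fin n) K)))
      (⊤ : Submodule (MvPolynomial (Fin n) K) (Ideal.span G)) Module.Finite.fg_top htop.le
    obtain ⟨x, hx, hx0⟩ := Submodule.exists_mem_ne_zero_of_ne_bot hne
    have hrx := congrArg Subtype.val (hr0 ⟨x, hx⟩ trivial)
    have hrz : r = 0 := (mul_eq_zero.1 hrx).resolve_right hx0
    rw [hrz, zero_sub] at hr
    have hle : Ideal.ofList ((ts ++ [z]).map X : List (MvPolynomial (Fin n) K)) ≤
        maxIdeal K n := by
      refine Ideal.span_le.2 fun r hr => ?_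
      obtain ⟨i, -, rfl⟩ := List.mem_map.1 hr
      exact X_mem_maxIdeal i
    exact one_notMem_maxIdeal (neg_mem_iff.1 (hle hr))

end DivisionByVariable

end SquarefreeAndCoordinates

/-! ### Bounds for the Hilbert depth of `S/I` and `I` -/

section HilbertDepthBounds

variable {K : Type u} [Field K] {n : ℕ} {I : Ideal (MvPolynomial (Fin n) K)}

theorem depth_le_hdepth_quotientGrading (hI : IsGradedSub homogeneousComponent I) :
    depth K n (MvPolynomial (Fin n) K ⧸ I) ≤ hdepth n (quotientGrading I) :=
  le_sSup ⟨MvPolynomial (Fin n) K ⧸ I, inferInstance, inferInstance, inferInstance, inferInstance,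
    quotientGrading I, inferInstance, isGradedModule_quotientGrading hI, rfl, rfl⟩

theorem hdepth_quotientGrading_le [Infinite K] {d : ℕ}
    (hd : ∀ F : Finset (Fin n), (∏ j ∈ F, X j : MvPolynomial (Fin n) K) ∉ I → F.card ≤ d) :
    hdepth n (quotientGrading I) ≤ d := by
  refine sSup_le ?_
  rintro _ ⟨N, _, _, _, _, 𝒩, _, h𝒩, hH, rfl⟩
  have hfin : ∀ j, Module.finrank K (𝒩 j) = Module.finrank K (quotientGrading I j) := by
    intro j
    have := congrArg (PowerSeries.coeff j) hH
    simpa [hilbertSeries] using this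
  refine depth_le_of_sum_finrank_le h𝒩 (C := 2 ^ n) fun j => ?_
  simp only [hfin]
  exact sum_finrank_quotientGrading_le hd j

theorem eq_bot_of_finrank_idealGrading_eq_zero (hI : IsGradedSub homogeneousComponent I)
    (h : ∀ j, Module.finrank K (idealGrading I j) = 0) : I = ⊥ := by
  have hfd := (isGradedModule_idealGrading hI).finiteDimensional
  rw [eq_bot_iff]
  intro f hf
  rw [Submodule.mem_bot, ← sum_homogeneousComponent f]
  refine Finset.sum_eq_zero fun j _ => ?_
  have hmem : (⟨_, hI j f hf⟩ : I) ∈ idealGrading I j := homogeneousComponent_mem j f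
  rw [Submodule.finrank_eq_zero.1 (h j), Submodule.mem_bot] at hmem
  exact congrArg Subtype.val hmem

/-- The witness is the degeneration `Ideal.span G` of `I` in new coordinates: it shares the Hilbert
function of `I`, and `d` regular variables together with a spare one `z` give its depth. -/
theorem succ_le_hdepth_idealGrading [Infinite K] (hI : IsGradedSub homogeneousComponent I)
    (hle : I ≤ maxIdeal K n) (hne : I ≠ ⊥) {d : ℕ} (hdn : d < n)
    (hd : (d : ℕ∞) ≤ depth K n (MvPolynomial (Fin n) K ⧸ I)) :
    (d : ℕ∞) + 1 ≤ hdepth n (idealGrading I) := by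
  obtain ⟨v, hv⟩ := (depthGE_of_le_depth hd).exists_linForm
  have hind : LinearIndependent K v := Fintype.linearIndependent_iff.2 fun c hc =>
    congrFun (linForm_independent hle hv (by rw [hc, map_zero]; exact zero_mem _))
  obtain ⟨A, t, ht, hAt⟩ := exists_linearEquiv_single hind
  set I' := I.comap (substLinearEquiv A)
  have hI' : IsGradedSub homogeneousComponent I' := hI.comap_substLinearEquiv A
  have hreg : RegSeqMod ((List.ofFn t).map X) I' := by
    refine RegSeqMod.comap (substLinearEquiv A) ?_
    rw [List.map_map, List.map_ofFn]
    have hvars : (substLinearEquiv A ∘ X ∘ t : Fin d → MvPolynomial (Fin n) K) =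
        fun i => linForm K n (v i) := by
      funext i
      rw [← hAt]
      exact substLinear_X _ _
    rw [Function.comp_assoc, hvars]
    exact hv
  have hnodup : (List.ofFn t).Nodup := List.nodup_ofFn.2 ht
  obtain ⟨z, hz⟩ : ∃ z, z ∉ List.ofFn t := by
    by_contra! h
    have := Fintype.card_le_of_surjective t fun z => (List.mem_ofFn' _ _).1 (h z)
    simp at this
    omega
  set G : Set (MvPolynomial (Fin n) K) :=
    killVars (List.ofFn t) '' (I' : Set (MvPolynomial (Fin n) K))
  have hfin : ∀ j, Module.finrank K (idealGrading (Ideal.span G) j) =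
      Module.finrank K (idealGrading I j) := by
    intro j
    zify
    rw [finrank_idealGrading, finrank_idealGrading, hilbertFun_span_killVars hI' hnodup hreg,
      hilbertFun_comap_substLinearEquiv]
  have hG : Ideal.span G ≠ ⊥ := by
    intro hbot
    refine hne (eq_bot_of_finrank_idealGrading_eq_zero hI fun j => ?_)
    rw [← hfin, hbot]
    exact Module.finrank_zero_of_subsingleton
  have hdepth := depth_span_ge hnodup (G := G) (fun i hi => by
    rintro _ ⟨f, -, rfl⟩
    exact commutesDiv_killVars hi f) hz hG
  rw [List.length_ofFn] at hdepth
  refine le_trans (by exact_mod_cast hdepth) (le_sSup ⟨Ideal.span G, inferInstance,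
    inferInstance, inferInstance, inferInstance, idealGrading (Ideal.span G), inferInstance,
    isGradedModule_idealGrading (isGradedSub_span_killVars hI'), ?_, rfl⟩)
  ext j
  simp [hilbertSeries, hfin]

end HilbertDepthBounds

end HilbertDepth

end

/-! ### The main theorem -/

theorem theorem2p7 {K : Type u} [Field K] [Infinite K] {n : ℕ}
    (I : Ideal (MvPolynomial (Fin n) K))
    (hI : HilbertDepth.IsSquarefreeMonomialIdeal I) (hproper : I ≠ ⊤)
    (hCM : HilbertDepth.IsCohenMacaulayQuotient I) :
    (HilbertDepth.sdepthQuotient I ≤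
        HilbertDepth.hdepth n (HilbertDepth.quotientGrading I) ∧
      ((HilbertDepth.hdepth n (HilbertDepth.quotientGrading I) : ℕ∞) : WithBot ℕ∞) =
        ringKrullDim (MvPolynomial (Fin n) K ⧸ I) ∧
      ringKrullDim (MvPolynomial (Fin n) K ⧸ I) =
        ((HilbertDepth.depth K n (MvPolynomial (Fin n) K ⧸ I) : ℕ∞) : WithBot ℕ∞)) ∧
    (I ≠ ⊥ →
      HilbertDepth.hdepth n (HilbertDepth.idealGrading I) ≥
        HilbertDepth.hdepth n (HilbertDepth.quotientGrading I) + 1) := by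
  classical
  let Δ : Finset (Finset (Fin n)) :=
    Finset.univ.filter fun F => (∏ j ∈ F, X j : MvPolynomial (Fin n) K) ∉ I
  have hΔ : ∅ ∈ Δ := by
    simpa [Δ] using (Ideal.ne_top_iff_one I).1 hproper
  obtain ⟨F, hF, hmax⟩ := Δ.exists_max_image Finset.card ⟨_, hΔ⟩
  have hF' : (∏ j ∈ F, X j : MvPolynomial (Fin n) K) ∉ I := (Finset.mem_filter.1 hF).2
  have hd : ∀ F' : Finset (Fin n), (∏ j ∈ F', X j : MvPolynomial (Fin n) K) ∉ I →
      F'.card ≤ F.card := fun F' h => hmax F' (Finset.mem_filter.2 ⟨Finset.mem_univ _, h⟩)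
  have hgr := hI.isGradedSub
  have hup := HilbertDepth.hdepth_quotientGrading_le hd
  -- Cohen–Macaulayness turns the lower bound on dimension into one on depth.
  have hdim : (F.card : ℕ∞) ≤ HilbertDepth.depth K n (MvPolynomial (Fin n) K ⧸ I) := by
    have := hI.card_le_ringKrullDim hF'
    rw [hCM] at this
    exact WithBot.coe_le_coe.1 this
  have hle := HilbertDepth.depth_le_hdepth_quotientGrading hgr
  have heq : HilbertDepth.hdepth n (HilbertDepth.quotientGrading I) = F.card :=
    le_antisymm hup (hdim.trans hle)
  have hdepth : HilbertDepth.depth K n (MvPolynomial (Fin n) K ⧸ I) = F.card :=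
    le_antisymm (hle.trans hup) hdim
  refine ⟨⟨?_, ?_, hCM⟩, fun hne => ?_⟩
  · rw [heq]
    exact HilbertDepth.sdepthQuotient_le hproper hd
  · rw [heq, hCM, hdepth]
  · rw [heq]
    refine HilbertDepth.succ_le_hdepth_idealGrading hgr (hI.le_maxIdeal hproper) hne ?_ hdim
    -- A face consisting of all variables is impossible, since a nonzero squarefree monomial ideal
    -- contains their product.
    refine lt_of_le_of_ne ((Finset.card_le_univ F).trans_eq (Fintype.card_fin n)) fun h => hF' ?_
    have huniv : F = Finset.univ := by
      rw [← Finset.card_eq_iff_eq_univ, h, Fintype.card_fin]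
    rw [huniv]
    exact hI.prod_univ_mem hne
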